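/- Let $T$ be a finite tree with at least two vertices. Let $\gamma_c(T)$ be the connected domination number, i.e. the least size of a dominating set that induces a connected subgraph. Let $\gamma_{\mathrm m}^{\infty}(T)$ be the m-eternal domination number, i.e. the least number of guards, placed on distinct vertices of $T$, that can answer every infinite sequence of attacks on vertices (each attack being chosen depending on the current position) in the following game: the vertices occupied by guards always form a dominating set; in response to each attack every guard either stays or moves to an adjacent vertex, with at most one guard on a vertex after the move, and the attacked vertex must then be occupied. A leaf is a vertex of degree one; a loner of $T$ is a vertex of $T$ that is not a leaf of $T$ and is adjacent to no leaf of $T$. Then $\gamma_{\mathrm m}^{\infty}(T) < 1 + \gamma_c(T)$ if and only if there are integers $r, k \ge 0$ such that $T$ has a spanning forest (an acyclic subgraph containing all vertices of $T$) whose components are exactly $r$ copies of $K_2$ and $k$ trees $T_1,\dots,T_k$ on at least three vertices each, and such that at least $k$ loners of $T$ are leaves of these $k+r$ trees. -/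

import Mathlib

/-!
Eternal domination (all guards may move), connected domination, loners and
spanning forests of a simple graph.
-/

namespace EternalDomination

variable {V : Type*}

/-- `D` is a dominating set of `G`: every vertex outside `D` has a neighbour in `D`. -/
def IsDominating (G : SimpleGraph V) (D : Finset V) : Prop :=
  ∀ u, u ∉ D → ∃ x ∈ D, G.Adj x u

/-- `D` is a connected dominating set of `G`. -/
def IsConnectedDominating (G : SimpleGraph V) (D : Finset V) : Prop :=
  IsDominating G D ∧ (G.induce (D : Set V)).Connected

/-- The connected domination number `γ_c(G)`. -/
noncomputable def connectedDominationNumber (G : SimpleGraph V) : ℕ :=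
  sInf {k | ∃ D : Finset V, IsConnectedDominating G D ∧ D.card = k}

/-- The guards on `D` can rearrange themselves onto `D'` in one turn: each guard stays or moves
along an edge, and no two guards end on the same vertex. -/
def GuardMove (G : SimpleGraph V) (D D' : Finset V) : Prop :=
  ∃ f : V → V, Set.BijOn f (D : Set V) (D' : Set V) ∧ ∀ v ∈ D, f v = v ∨ G.Adj v (f v)

/-- A winning strategy of the defender. `σ h` is the set of vertices occupied after the sequence
of attacks `h` (most recent attack first); `σ []` is the initial configuration. All
configurations are dominating, and each attack `r` is answered by a move of the guards after which
`r` is occupied. (An attack on an occupied vertex can be answered by not moving, so allowing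
such attacks makes no difference.) -/
structure IsDefence (G : SimpleGraph V) (σ : List V → Finset V) : Prop where
  dominating : ∀ h, IsDominating G (σ h)
  move : ∀ h r, GuardMove G (σ h) (σ (r :: h))
  defended : ∀ h r, r ∈ σ (r :: h)

/-- `D` is an m-eternal dominating set: the defender, starting from guards on `D`, can
answer every infinite sequence of attacks. -/
def IsMEternalDominating (G : SimpleGraph V) (D : Finset V) : Prop :=
  ∃ σ : List V → Finset V, σ [] = D ∧ IsDefence G σ

/-- The m-eternal domination number `γ_m^∞(G)`. -/
noncomputable def mEternalDominationNumber (G : SimpleGraph V) : ℕ :=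
  sInf {k | ∃ D : Finset V, IsMEternalDominating G D ∧ D.card = k}

/-- A leaf is a vertex of degree one. -/
def IsLeaf (G : SimpleGraph V) (v : V) : Prop :=
  (G.neighborSet v).ncard = 1

/-- A loner is an internal vertex (that is, not a leaf) which is adjacent to no leaf. -/
def IsLoner (G : SimpleGraph V) (v : V) : Prop :=
  ¬ IsLeaf G v ∧ ∀ w, G.Adj v w → ¬ IsLeaf G w

/-- `H` is a spanning forest of `G` whose components are `r` copies of `K₂` (a connected graph with
two vertices is a `K₂`) and `k` trees on at least three vertices. -/
structure IsSpanningForestOfType (G H : SimpleGraph V) (r k : ℕ) : Prop where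
  le : H ≤ G
  acyclic : H.IsAcyclic
  components : ∀ c : H.ConnectedComponent, c.supp.ncard = 2 ∨ 3 ≤ c.supp.ncard
  card_two : {c : H.ConnectedComponent | c.supp.ncard = 2}.ncard = r
  card_large : {c : H.ConnectedComponent | 3 ≤ c.supp.ncard}.ncard = k

end EternalDomination

namespace EternalDomination

open SimpleGraph

/-! Let the weight of a spanning forest be the number of its components plus the number of its
vertices of degree at least two; `ForestBound` records an upper bound `R.card + J.card` for it. For
a tree, the m-eternal domination number is the least weight of a spanning forest. In one direction,
each component is defended by guards on all its vertices of degree at least two and one roaming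
guard on a further vertex (`ForestBound.exists_isMEternalDominating`). In the other, pendant pairs
and pendant bunches of leaves are stripped off, each saving one guard
(`IsGuardFamily.exists_forestBound`). On at least three vertices, γ_c(T) is the number of non-leaves
of `T`, so the inequality says that some forest has weight at most the number of non-leaves.

Given such a forest, isolated vertices can be attached at no cost. At least r + k non-leaves of `T`
are then leaves of the forest, and those that are not loners lie in distinct copies of K₂, so at
least k are loners (`ForestBound.card_large_le`).

Conversely, compare the excess of a component (weight minus number of non-leaves of `T` in it) with
its value (1 if large, else 0, minus the number of its loner leaves). Excess is at most value except
for a K₂ made of two loners, where they are -1 and -2. To repair this, `excessLE_zero` shows by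
induction that a connected union of components with value at most 0 carries a forest, possibly a new
one, of excess at most 0. Either the union splits into two such parts, or some component has only
parts of positive value around it. A connected part has excess at most 1, hence at most its value,
and a central pair of loners is cut apart, its ends becoming leaves of neighbouring parts
(`excessLE_zero_of_center`). -/

/-- The subgraph of `G` (on the same vertex type) consisting of the edges inside `X`. -/
def restrict {V : Type*} (G : SimpleGraph V) (X : Finset V) : SimpleGraph V where
  Adj a b := G.Adj a b ∧ a ∈ X ∧ b ∈ X
  symm := ⟨fun _ _ h => ⟨h.1.symm, h.2.2, h.2.1⟩⟩
  loopless := ⟨fun _ h => G.loopless.irrefl _ h.1⟩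

lemma restrict_le {V : Type*} (G : SimpleGraph V) (X : Finset V) : restrict G X ≤ G :=
  fun _ _ h => h.1

/-- A subgraph `F` of `G` such that `R` meets every component of `F` that meets `U`, and `J`
contains every vertex of `F` of degree at least two. -/
structure ForestBound {V : Type*} (G : SimpleGraph V) (U : Finset V) (F : SimpleGraph V)
    (R J : Finset V) : Prop where
  le : F ≤ G
  cover : ∀ u ∈ U, ∃ r ∈ R, F.Reachable r u
  branch : ∀ v, v ∉ J → ∀ a b, F.Adj v a → F.Adj v b → a = b

/-- A family of positions of `m` labelled guards (several guards may share a vertex), closed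
under relabelling, from each member of which every attack on `U` can be answered within the
family. -/
structure IsGuardFamily {V : Type*} (G : SimpleGraph V) (U : Finset V) {m : ℕ}
    (C : Set (Fin m → V)) : Prop where
  nonempty : C.Nonempty
  perm : ∀ c ∈ C, ∀ σ : Equiv.Perm (Fin m), c ∘ σ ∈ C
  respond : ∀ c ∈ C, ∀ r ∈ U, ∃ c' ∈ C, (∀ i, c i = c' i ∨ G.Adj (c i) (c' i)) ∧ ∃ i, c' i = r

/-! ### Lower bound: guards saved by stripping the ends of a forest -/

section GuardFamily

variable {V : Type*} {G G' : SimpleGraph V} {U U' : Finset V}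

lemma IsGuardFamily.dominated {m : ℕ} {C : Set (Fin m → V)} (h : IsGuardFamily G U C)
    {c : Fin m → V} (hc : c ∈ C) {r : V} (hr : r ∈ U) : ∃ i, c i = r ∨ G.Adj (c i) r := by
  obtain ⟨c', -, hm, i, hi⟩ := h.respond c hc r hr
  exact ⟨i, by simpa [hi] using hm i⟩

/-- Collapsing a set `S` which always contains a guard and has at most one exit, and
dropping one guard in `S`. -/
lemma IsGuardFamily.collapse {m : ℕ} {C : Set (Fin (m + 1) → V)} (h : IsGuardFamily G U C)
    (S : Set V) (φ : V → V)
    (hφ : ∀ a b, G.Adj a b → φ a = φ b ∨ G'.Adj (φ a) (φ b))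
    (hS : ∀ c ∈ C, ∃ i, c i ∈ S)
    (hconst : ∀ a ∈ S, ∀ b ∈ S, φ a = φ b)
    (hexit : ∀ a ∈ S, ∀ b, b ∉ S → G.Adj a b → ∀ a' ∈ S, ∀ b', b' ∉ S → G.Adj a' b' → b = b')
    (hattack : ∀ r ∈ U', ∃ r₀ ∈ U, ∀ c ∈ C, (∃ i, c i = r₀) → ∀ j, c j ∈ S →
      ∃ i, i ≠ j ∧ φ (c i) = r) :
    IsGuardFamily G' U' {c : Fin m → V | ∃ c₀ ∈ C, c₀ 0 ∈ S ∧ c = φ ∘ c₀ ∘ Fin.succ} := by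
  have hφ' : ∀ a b, a = b ∨ G.Adj a b → φ a = φ b ∨ G'.Adj (φ a) (φ b) := by
    rintro a b (rfl | hab)
    · exact Or.inl rfl
    · exact hφ a b hab
  have toZero : ∀ c ∈ C, ∀ j, c j ∈ S → c ∘ Equiv.swap 0 j ∈ C ∧ (c ∘ Equiv.swap 0 j) 0 ∈ S := by
    intro c hc j hj
    exact ⟨h.perm c hc _, by simpa using hj⟩
  refine ⟨?_, ?_, ?_⟩
  · obtain ⟨c, hc⟩ := h.nonempty
    obtain ⟨j, hj⟩ := hS c hc
    obtain ⟨h1, h2⟩ := toZero c hc j hj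
    exact ⟨_, _, h1, h2, rfl⟩
  · rintro _ ⟨c, hc, h0, rfl⟩ σ
    refine ⟨c ∘ Equiv.Perm.decomposeFin.symm (0, σ), h.perm c hc _, by simpa using h0, ?_⟩
    funext i
    simp
  · rintro _ ⟨c, hc, h0, rfl⟩ r hr
    obtain ⟨r₀, hr₀, hatt⟩ := hattack r hr
    obtain ⟨c', hc', hmove, hhit⟩ := h.respond c hc r₀ hr₀
    by_cases h0' : c' 0 ∈ S
    · refine ⟨φ ∘ c' ∘ Fin.succ, ⟨c', hc', h0', rfl⟩, fun i => hφ' _ _ (hmove _), ?_⟩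
      obtain ⟨i, hi, hir⟩ := hatt c' hc' hhit 0 h0'
      obtain ⟨k, rfl⟩ := Fin.exists_succ_eq.mpr hi
      exact ⟨k, hir⟩
    -- The dropped guard has left `S`, so a guard `j` now in `S` is dropped in its place, and the
    -- old dropped guard takes over the label of `j`.
    · obtain ⟨j, hj⟩ := hS c' hc'
      obtain ⟨h1, h2⟩ := toZero c' hc' j hj
      refine ⟨_, ⟨_, h1, h2, rfl⟩, fun i => ?_, ?_⟩
      · by_cases hij : i.succ = j
        · subst hij
          have e : (φ ∘ (c' ∘ Equiv.swap 0 i.succ) ∘ Fin.succ) i = φ (c' 0) := by simp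
          rw [e]
          have hadj : G.Adj (c 0) (c' 0) := by
            rcases hmove 0 with h' | h'
            · exact absurd (h' ▸ h0) h0'
            · exact h'
          by_cases hcj : c i.succ ∈ S
          · have := hφ _ _ hadj
            rwa [hconst _ h0 _ hcj] at this
          · left
            have hadj' : G.Adj (c i.succ) (c' i.succ) := by
              rcases hmove i.succ with h' | h'
              · exact absurd (h' ▸ hj) hcj
              · exact h'
            exact congrArg φ (hexit _ hj _ hcj hadj'.symm _ h0 _ h0' hadj)
        · have e : (φ ∘ (c' ∘ Equiv.swap 0 j) ∘ Fin.succ) i = φ (c' i.succ) := by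
            simp [Equiv.swap_apply_of_ne_of_ne (Fin.succ_ne_zero i) hij]
          rw [e]
          exact hφ' _ _ (hmove _)
      · have hhit' : ∃ i, (c' ∘ Equiv.swap 0 j) i = r₀ := by
          obtain ⟨i, hi⟩ := hhit
          exact ⟨Equiv.swap 0 j i, by simpa using hi⟩
        obtain ⟨i, hi, hir⟩ := hatt _ h1 hhit' 0 h2
        obtain ⟨k, rfl⟩ := Fin.exists_succ_eq.mpr hi
        exact ⟨k, hir⟩

/-- In a finite acyclic graph there is a vertex `x` with a neighbour `l` of degree one all of
whose neighbours, with at most one exception `p`, have degree one; or `x = l` is isolated. -/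
lemma exists_end_star [Finite V] (hG : G.IsAcyclic) (hU : ∀ u ∈ U, ∃ v, G.Adj u v)
    (hne : U.Nonempty) :
    ∃ x l p, G.Adj x l ∧ (∀ y, G.Adj l y → y = x) ∧
      ∀ y, G.Adj x y → y = p ∨ ∀ z, G.Adj y z → z = x := by
  classical
  have := Fintype.ofFinite V
  let P : ℕ → Prop := fun n => ∃ (a b : V) (q : G.Walk a b), q.IsPath ∧ q.length = n
  have hbd : ∀ n, P n → n ≤ Fintype.card V := by
    rintro n ⟨a, b, q, hq, rfl⟩
    exact hq.length_lt.le
  obtain ⟨u, hu⟩ := hne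
  obtain ⟨v, huv⟩ := hU u hu
  have h1 : P 1 := ⟨u, v, Walk.cons huv Walk.nil, by simp [huv.ne], rfl⟩
  have hspec : P (Nat.findGreatest P (Fintype.card V)) := Nat.findGreatest_spec (hbd 1 h1) h1
  have hmax : ∀ n, P n → n ≤ Nat.findGreatest P (Fintype.card V) :=
    fun n hn => Nat.le_findGreatest (hbd n hn) hn
  have h1' := hmax 1 h1
  obtain ⟨a, b, q, hq, hlen⟩ := hspec
  rw [← hlen] at hmax h1'
  -- The first vertex of a longest path has one neighbour: another would prolong the path or close a
  -- cycle.
  have hend : ∀ (a x : V) (h : G.Adj a x) (t : G.Walk x b), (Walk.cons h t).IsPath →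
      (Walk.cons h t).length = q.length → ∀ y, G.Adj a y → y = x := by
    intro a x h t ht hl y hy
    by_cases hmem : y ∈ (Walk.cons h t).support
    · simpa using hG.eq_snd_of_adj_start ht hy hmem
    · have := hmax _ ⟨y, b, Walk.cons hy.symm (Walk.cons h t), ht.cons hmem, rfl⟩
      simp only [Walk.length_cons] at this hl
      omega
  cases q with
  | nil => simp at h1'
  | @cons _ x _ hax t =>
    have hax' := hend a x hax t hq rfl
    cases t with
    | nil =>
      refine ⟨b, a, a, hax.symm, hax', fun y hy => Or.inl ?_⟩
      by_contra hya
      have := hmax _ ⟨y, a, Walk.cons hy.symm (Walk.cons hax.symm Walk.nil),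
        by simp [hya, hax.ne', hy.ne'], rfl⟩
      simp at this
    | @cons _ p _ hxp s =>
      refine ⟨x, a, p, hax.symm, hax', fun y hy => ?_⟩
      rw [or_iff_not_imp_left]
      intro hyp
      have ht := hq.of_cons
      have hmem : y ∉ (Walk.cons hxp s).support := by
        intro hmem
        exact hyp (by simpa using hG.eq_snd_of_adj_start ht hy hmem)
      -- Replacing the first vertex by `y` gives another longest path.
      exact hend y x hy.symm _ (ht.cons hmem) rfl

/-- Deleting the end `{x, l}` saves a guard. -/
lemma IsGuardFamily.delete_pair [DecidableEq V] {m : ℕ} {C : Set (Fin (m + 1) → V)}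
    (h : IsGuardFamily G U C) {x l p : V} (hl : l ∈ U) (hlx : ∀ y, G.Adj l y → y = x)
    (hx : ∀ y, G.Adj x y → y = l ∨ y = p) {W : Finset V} (hW : ∀ a, a ∈ W ↔ a ≠ x ∧ a ≠ l) :
    ∃ C' : Set (Fin m → V), IsGuardFamily (restrict G W) (U \ {x, l}) C' := by
  classical
  -- The pair is collapsed onto its exit if there is one; otherwise onto `x`, isolated in the new
  -- graph, where guards stay idle.
  let z := if G.Adj x p ∧ p ≠ l then p else x
  let φ : V → V := fun y => if y = x ∨ y = l then z else y
  have hcross : ∀ a b, (a = x ∨ a = l) → ¬ (b = x ∨ b = l) → G.Adj a b → b = p ∧ z = p := by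
    intro a b ha hb hab
    rcases ha with rfl | rfl
    · have hbp : b = p := (hx b hab).resolve_left fun h => hb (Or.inr h)
      subst hbp
      exact ⟨rfl, if_pos ⟨hab, fun h => hb (Or.inr h)⟩⟩
    · exact absurd (Or.inl (hlx b hab)) hb
  refine ⟨_, h.collapse (G' := restrict G W) (U' := U \ {x, l}) {y | y = x ∨ y = l} φ
    ?_ ?_ ?_ ?_ ?_⟩
  · intro a b hab
    by_cases ha : a = x ∨ a = l <;> by_cases hb : b = x ∨ b = l
    · left; simp [φ, ha, hb]
    · left
      obtain ⟨h1, h2⟩ := hcross a b ha hb hab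
      simp [φ, if_pos ha, h1.symm ▸ h2]
    · left
      obtain ⟨h1, h2⟩ := hcross b a hb ha hab.symm
      simp [φ, if_pos hb, h1.symm ▸ h2]
    · right
      simp only [φ, ha, hb, if_false]
      exact ⟨hab, (hW a).2 (not_or.1 ha), (hW b).2 (not_or.1 hb)⟩
  · intro c hc
    obtain ⟨i, hi⟩ := h.dominated hc hl
    rcases hi with hi | hi
    · exact ⟨i, Or.inr hi⟩
    · exact ⟨i, Or.inl (hlx _ hi.symm)⟩
  · intro a ha b hb
    have ha' : a = x ∨ a = l := ha
    have hb' : b = x ∨ b = l := hb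
    simp [φ, ha', hb']
  · intro a ha b hb hab a' ha' b' hb' hab'
    rw [(hcross a b ha hb hab).1, (hcross a' b' ha' hb' hab').1]
  · intro r hr
    simp only [Finset.mem_sdiff, Finset.mem_insert, Finset.mem_singleton] at hr
    refine ⟨r, hr.1, ?_⟩
    rintro c hc ⟨i, hi⟩ j hj
    refine ⟨i, ?_, ?_⟩
    · rintro rfl
      exact hr.2 (hi ▸ hj)
    · simp only [φ, hi, hr.2, if_false]

/-- Deleting at least two leaves at a vertex `x` with a single other neighbour saves a guard. -/
lemma IsGuardFamily.delete_leaves [DecidableEq V] {m : ℕ}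
    {C : Set (Fin (m + 1) → V)}
    (h : IsGuardFamily G U C) {x p l l' : V} {L W : Finset V} (hL : ∀ y, y ∈ L ↔ G.Adj x y ∧ y ≠ p)
    (hleaf : ∀ y ∈ L, ∀ z, G.Adj y z → z = x) (hLU : L ⊆ U)
    (hl : l ∈ L) (hl' : l' ∈ L) (hne : l ≠ l') (hW : ∀ a, a ∈ W ↔ a ∉ L) :
    ∃ C' : Set (Fin m → V), IsGuardFamily (restrict G W) (U \ L) C' := by
  classical
  let φ : V → V := fun y => if y ∈ L then x else y
  have hxL : x ∉ L := fun hx => G.loopless.irrefl _ ((hL x).1 hx).1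
  have hcross : ∀ a b, (a = x ∨ a ∈ L) → ¬ (b = x ∨ b ∈ L) → G.Adj a b → b = p := by
    intro a b ha hb hab
    rcases ha with rfl | ha
    · by_contra hbp
      exact hb (Or.inr ((hL b).2 ⟨hab, hbp⟩))
    · exact absurd (Or.inl (hleaf a ha b hab)) hb
  have hφS : ∀ a, (a = x ∨ a ∈ L) → φ a = x := by
    rintro a (rfl | ha)
    · simp [φ]
    · simp [φ, ha]
  refine ⟨_, h.collapse (G' := restrict G W) (U' := U \ L) {y | y = x ∨ y ∈ L} φ ?_ ?_ ?_ ?_ ?_⟩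
  · intro a b hab
    by_cases ha : a ∈ L
    · left
      rw [hleaf a ha b hab, hφS a (Or.inr ha), hφS x (Or.inl rfl)]
    by_cases hb : b ∈ L
    · left
      rw [hleaf b hb a hab.symm, hφS b (Or.inr hb), hφS x (Or.inl rfl)]
    right
    simp only [φ, ha, hb, if_false]
    exact ⟨hab, (hW a).2 ha, (hW b).2 hb⟩
  · intro c hc
    obtain ⟨i, hi⟩ := h.dominated hc (hLU hl)
    rcases hi with hi | hi
    · exact ⟨i, Or.inr (hi ▸ hl)⟩
    · exact ⟨i, Or.inl (hleaf l hl _ hi.symm)⟩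
  · intro a ha b hb
    rw [hφS a ha, hφS b hb]
  · intro a ha b hb hab a' ha' b' hb' hab'
    rw [hcross a b ha hb hab, hcross a' b' ha' hb' hab']
  · intro r hr
    rw [Finset.mem_sdiff] at hr
    by_cases hrx : r = x
    · subst hrx
      -- An attack on `x` is simulated by one on `l`: a guard stands on `l` and another on `x` or
      -- `l'`, so one remains over `x` whichever guard of the star is dropped.
      refine ⟨l, hLU hl, ?_⟩
      rintro c hc ⟨i, hi⟩ j hj
      obtain ⟨k, hk⟩ := h.dominated hc (hLU hl')
      have hk' : c k = r ∨ c k = l' := by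
        rcases hk with hk | hk
        · exact Or.inr hk
        · exact Or.inl (hleaf l' hl' _ hk.symm)
      by_cases hij : i = j
      · refine ⟨k, ?_, ?_⟩
        · rintro rfl
          subst hij
          rcases hk' with h' | h'
          · exact hxL (h' ▸ hi ▸ hl)
          · exact hne (hi ▸ h')
        · rcases hk' with h' | h'
          · exact hφS _ (Or.inl h')
          · exact hφS _ (Or.inr (h' ▸ hl'))
      · exact ⟨i, hij, hφS _ (Or.inr (hi ▸ hl))⟩
    · refine ⟨r, hr.1, ?_⟩
      rintro c hc ⟨i, hi⟩ j hj
      refine ⟨i, ?_, by simp only [φ, hi, hr.2, if_false]⟩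
      rintro rfl
      rcases hj with h' | h'
      · exact hrx (hi ▸ h')
      · exact hr.2 (hi ▸ h')

/-- The pair becomes a component of its own, represented by `x`, and neither end gets degree two, so
only `R` grows. The case `x = l` is that of an isolated vertex. -/
lemma ForestBound.extend_pair [DecidableEq V] {x l : V} {F' : SimpleGraph V} {W R J : Finset V}
    (hW : ∀ a, a ∈ W ↔ a ≠ x ∧ a ≠ l) (hxl : x = l ∨ G.Adj x l)
    (hlx : ∀ y, G.Adj l y → y = x)
    (h : ForestBound (restrict G W) (U \ {x, l}) F' R J) :
    ForestBound G U (F' ⊔ restrict G {x, l}) (insert x R) J := by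
  refine ⟨sup_le (h.le.trans (restrict_le _ _)) (restrict_le _ _), ?_, ?_⟩
  · intro u hu
    by_cases hux : u = x
    · exact ⟨x, by simp, hux ▸ Reachable.refl _⟩
    by_cases hul : u = l
    · refine ⟨x, by simp, ?_⟩
      subst hul
      rcases hxl with h' | h'
      · exact h' ▸ Reachable.refl _
      · exact Adj.reachable (Or.inr ⟨h', by simp, by simp⟩)
    · obtain ⟨r, hr, hru⟩ := h.cover u (by simp [hu, hux, hul])
      exact ⟨r, by simp [hr], hru.mono le_sup_left⟩
  · intro v hv a b hva hvb
    have key : ∀ c, (F' ⊔ restrict G {x, l}).Adj v c → F'.Adj v c ∨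
        (v = x ∧ c = l) ∨ (v = l ∧ c = x) := by
      rintro c (hc | ⟨hc, h1, h2⟩)
      · exact Or.inl hc
      · have := hc.ne
        simp only [Finset.mem_insert, Finset.mem_singleton] at h1 h2
        grind
    have hF' : ∀ c, F'.Adj v c → v ≠ x ∧ v ≠ l := fun c hc => (hW v).1 (h.le hc).2.1
    rcases key a hva with ha | ha | ha <;> rcases key b hvb with hb | hb | hb
    · exact h.branch v hv a b ha hb
    · exact absurd hb.1 (hF' a ha).1
    · exact absurd hb.1 (hF' a ha).2
    · exact absurd ha.1 (hF' b hb).1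
    · grind
    · grind
    · exact absurd ha.1 (hF' b hb).2
    · grind
    · grind

/-- The leaves are hung on `x`, whose component already meets `R`; only `x` can newly reach degree
two, so only `J` grows. -/
lemma ForestBound.extend_leaves [DecidableEq V] {x : V} {F' : SimpleGraph V} {L W R J : Finset V}
    (hL : ∀ y ∈ L, G.Adj x y) (hx : x ∈ U) (hleaf : ∀ y ∈ L, ∀ z, G.Adj y z → z = x)
    (h : ForestBound (restrict G W) (U \ L) F' R J) :
    ForestBound G U (F' ⊔ restrict G (insert x L)) R (insert x J) := by
  have hle : F' ⊔ restrict G (insert x L) ≤ G :=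
    sup_le (h.le.trans (restrict_le _ _)) (restrict_le _ _)
  refine ⟨hle, ?_, ?_⟩
  · intro u hu
    by_cases huL : u ∈ L
    · have hxL : x ∉ L := fun hx => G.loopless.irrefl _ (hL x hx)
      obtain ⟨r, hr, hrx⟩ := h.cover x (by simp [hx, hxL])
      refine ⟨r, hr, (hrx.mono le_sup_left).trans (Adj.reachable (Or.inr ⟨hL u huL, ?_, ?_⟩))⟩ <;>
        simp [huL]
    · obtain ⟨r, hr, hru⟩ := h.cover u (by simp [hu, huL])
      exact ⟨r, hr, hru.mono le_sup_left⟩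
  · intro v hv a b hva hvb
    rw [Finset.mem_insert, not_or] at hv
    by_cases hvL : v ∈ L
    · rw [hleaf v hvL a (hle hva), hleaf v hvL b (hle hvb)]
    · have key : ∀ c, (F' ⊔ restrict G (insert x L)).Adj v c → F'.Adj v c := by
        rintro c (hc | ⟨hc, h1, h2⟩)
        · exact hc
        · simp [hv.1, hvL] at h1
      exact h.branch v hv.2 a b (key a hva) (key b hvb)

/-- The lower bound for the eternal domination game on an acyclic graph. -/
theorem IsGuardFamily.exists_forestBound [Finite V] (hG : G.IsAcyclic)
    (hU : ∀ a b, G.Adj a b → a ∈ U) {m : ℕ} {C : Set (Fin m → V)} (h : IsGuardFamily G U C) :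
    ∃ F R J, ForestBound G U F R J ∧ R.card + J.card ≤ m := by
  classical
  have := Fintype.ofFinite V
  induction hn : U.card using Nat.strong_induction_on generalizing G U m with
  | _ n ih =>
    subst hn
    rcases U.eq_empty_or_nonempty with rfl | ⟨w, hw⟩
    · refine ⟨⊥, ∅, ∅, ⟨bot_le, by simp, ?_⟩, by simp⟩
      intro v _ a b hva
      simp at hva
    obtain _ | m := m
    · obtain ⟨c, hc⟩ := h.nonempty
      obtain ⟨i, -⟩ := h.dominated hc hw
      exact i.elim0
    have pair : ∀ x l p : V, x ∈ U → l ∈ U → (x = l ∨ G.Adj x l) → (∀ y, G.Adj l y → y = x) →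
        (∀ y, G.Adj x y → y = l ∨ y = p) →
        ∃ F R J, ForestBound G U F R J ∧ R.card + J.card ≤ m + 1 := by
      intro x l p hxU hlU hxl hlx hx
      have hW : ∀ a, a ∈ Finset.univ.filter (fun a => a ≠ x ∧ a ≠ l) ↔ a ≠ x ∧ a ≠ l := by simp
      obtain ⟨C', hC'⟩ := h.delete_pair hlU hlx hx hW
      obtain ⟨F, R, J, hF, hcard⟩ := ih (U \ {x, l}).card
        (Finset.card_lt_card ⟨Finset.sdiff_subset, fun hs => by simpa using hs hxU⟩)
        (hG.anti (restrict_le _ _)) (fun a b hab => by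
          have := (hW a).1 hab.2.1
          simp [hU a b hab.1, this]) hC' rfl
      refine ⟨_, _, _, hF.extend_pair hW hxl hlx, ?_⟩
      have := Finset.card_insert_le x R
      omega
    by_cases hiso : ∀ u ∈ U, ∃ v, G.Adj u v
    swap
    · push Not at hiso
      obtain ⟨u, hu, huv⟩ := hiso
      exact pair u u u hu hu (Or.inl rfl) (fun y hy => absurd hy (huv y))
        (fun y hy => absurd hy (huv y))
    obtain ⟨x, l, p, hxl, hlx, hp⟩ := exists_end_star hG hiso ⟨w, hw⟩
    have hxU := hU x l hxl
    by_cases htwo : ∃ a b, a ≠ b ∧ a ≠ p ∧ b ≠ p ∧ G.Adj x a ∧ G.Adj x b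
    · obtain ⟨a, b, hab, hap, hbp, hxa, hxb⟩ := htwo
      set L := Finset.univ.filter (fun y => G.Adj x y ∧ y ≠ p) with hLdef
      have hL : ∀ y, y ∈ L ↔ G.Adj x y ∧ y ≠ p := by simp [hLdef]
      have hleaf : ∀ y ∈ L, ∀ z, G.Adj y z → z = x := fun y hy =>
        (hp y ((hL y).1 hy).1).resolve_left ((hL y).1 hy).2
      have hLU : L ⊆ U := fun y hy => hU y x ((hL y).1 hy).1.symm
      have haL : a ∈ L := (hL a).2 ⟨hxa, hap⟩
      have hbL : b ∈ L := (hL b).2 ⟨hxb, hbp⟩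
      have hW : ∀ a, a ∈ Lᶜ ↔ a ∉ L := by simp
      obtain ⟨C', hC'⟩ := h.delete_leaves hL hleaf hLU haL hbL hab hW
      obtain ⟨F, R, J, hF, hcard⟩ := ih (U \ L).card
        (Finset.card_lt_card ⟨Finset.sdiff_subset, fun hs =>
          (Finset.mem_sdiff.1 (hs (hLU haL))).2 haL⟩)
        (hG.anti (restrict_le _ _)) (fun a b hab => by
          have := (hW a).1 hab.2.1
          simp [hU a b hab.1, this]) hC' rfl
      refine ⟨_, _, _, hF.extend_leaves (fun y hy => ((hL y).1 hy).1) hxU hleaf, ?_⟩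
      have := Finset.card_insert_le x J
      omega
    · by_cases hone : ∃ a, a ≠ p ∧ G.Adj x a
      · obtain ⟨a, hap, hxa⟩ := hone
        refine pair x a p hxU (hU a x hxa.symm) (Or.inr hxa) ((hp a hxa).resolve_left hap) ?_
        intro y hy
        by_contra hcon
        push Not at hcon htwo
        exact htwo y a hcon.1 hcon.2 hap hy hxa
      · push Not at hone
        -- Here `p` is the only neighbour of `x`, so `l = p` and the pair is a whole component.
        refine pair x l p hxU (hU l x hxl.symm) (Or.inr hxl) hlx fun y hy => Or.inr ?_
        by_contra hyp
        exact hone y hyp hy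

end GuardFamily

/-- Every m-eternal dominating set of an acyclic graph is at least as large as the weight of some
spanning forest. -/
theorem IsMEternalDominating.exists_forestBound {V : Type*} [Finite V] {T : SimpleGraph V}
    (hT : T.IsAcyclic) {D : Finset V} (hD : IsMEternalDominating T D) :
    ∃ F R J, (∀ U, ForestBound T U F R J) ∧ R.card + J.card ≤ D.card := by
  classical
  have := Fintype.ofFinite V
  obtain ⟨σ, hσ, hdef⟩ := hD
  have hstep : ∀ h r, ∀ c : Fin D.card → V, Function.Injective c → Set.range c = σ h →
      ∃ c' : Fin D.card → V, Function.Injective c' ∧ Set.range c' = σ (r :: h) ∧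
        ∀ i, c i = c' i ∨ T.Adj (c i) (c' i) := by
    intro h r c hc hr
    obtain ⟨f, hf, hmove⟩ := hdef.move h r
    have hmem : ∀ i, c i ∈ σ h := fun i => by
      have : c i ∈ Set.range c := ⟨i, rfl⟩
      rwa [hr] at this
    refine ⟨f ∘ c, fun i j hij => hc (hf.injOn (hmem i) (hmem j) hij), ?_, fun i => ?_⟩
    · rw [Set.range_comp, hr, hf.image_eq]
    · rcases hmove (c i) (hmem i) with h' | h'
      · exact Or.inl h'.symm
      · exact Or.inr h'
  -- The family consists of all labellings of the positions that the strategy takes after some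
  -- history.
  have hfam : IsGuardFamily T Finset.univ
      {c : Fin D.card → V | Function.Injective c ∧ ∃ h, Set.range c = σ h} := by
    refine ⟨?_, ?_, ?_⟩
    · refine ⟨fun i => D.equivFin.symm i, fun i j hij => ?_, [], ?_⟩
      · simpa using Subtype.ext hij
      · ext v
        rw [hσ]
        constructor
        · rintro ⟨i, rfl⟩
          exact (D.equivFin.symm i).2
        · intro hv
          exact ⟨D.equivFin ⟨v, hv⟩, by simp⟩
    · rintro c ⟨hc, h, hr⟩ τ
      refine ⟨hc.comp τ.injective, h, ?_⟩
      rw [τ.surjective.range_comp, hr]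
    · rintro c ⟨hc, h, hr⟩ r -
      obtain ⟨c', h1, h2, h3⟩ := hstep h r c hc hr
      refine ⟨c', ⟨h1, _, h2⟩, h3, ?_⟩
      have : r ∈ Set.range c' := h2 ▸ Finset.mem_coe.2 (hdef.defended h r)
      exact this
  obtain ⟨F, R, J, hF, hcard⟩ := hfam.exists_forestBound hT (by simp)
  exact ⟨F, R, J, fun U => ⟨hF.le, fun u _ => hF.cover u (Finset.mem_univ _), hF.branch⟩, hcard⟩

/-! ### Upper bound: defending along a spanning forest -/

section UpperBound

variable {V : Type*} {G F T : SimpleGraph V}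

/-- The vertex `v` has at most one neighbour in `F`. -/
def AtMostOneNeighbour (F : SimpleGraph V) (v : V) : Prop :=
  ∀ a b, F.Adj v a → F.Adj v b → a = b

lemma not_atMostOneNeighbour_of_mem_support {s r : V} (p : G.Walk s r) (hp : p.IsPath) {v : V}
    (hv : v ∈ p.support) (hs : v ≠ s) (hr : v ≠ r) : ¬ AtMostOneNeighbour G v := by
  induction p with
  | nil => simp at hv; exact absurd hv hs
  | @cons s s₁ r h t ih =>
    rw [Walk.support_cons, List.mem_cons] at hv
    have hvt := hv.resolve_left hs
    by_cases hv1 : v = s₁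
    · subst hv1
      cases t with
      | nil => exact absurd rfl hr
      | @cons _ s₂ _ h' t' =>
        intro hone
        have := hone s s₂ h.symm h'
        subst this
        simp at hp
    · exact ih hp.of_cons hvt hv1 hr

lemma GuardMove.mono {D D' : Finset V} (h : GuardMove F D D') (hle : F ≤ T) : GuardMove T D D' := by
  obtain ⟨f, hf, hm⟩ := h
  exact ⟨f, hf, fun v hv => (hm v hv).imp id fun h => hle h⟩

lemma GuardMove.refl (D : Finset V) : GuardMove F D D :=
  ⟨id, Set.bijOn_id _, fun _ _ => Or.inl rfl⟩

/-- Guards on all inner vertices of a path and on its start can shift along the path. -/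
lemma guardMove_insert_of_isPath [DecidableEq V] {s r : V} (p : F.Walk s r) (hp : p.IsPath)
    (D : Finset V) (hs : s ∉ D) (hr : r ∉ D) (hin : ∀ v ∈ p.support, v ≠ s → v ≠ r → v ∈ D) :
    GuardMove F (insert s D) (insert r D) := by
  induction p generalizing D with
  | nil => exact GuardMove.refl _
  | @cons s s₁ r h t ih =>
    have key : ∀ D' : Finset V, ∀ f : V → V, Set.BijOn f (D : Set V) (D' : Set V) → s₁ ∉ D' →
        (∀ v ∈ D, f v = v ∨ F.Adj v (f v)) → GuardMove F (insert s D) (insert s₁ D') := by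
      intro D' f hf hs' hm
      refine ⟨Function.update f s s₁, ?_, ?_⟩
      · have hE : Set.EqOn f (Function.update f s s₁) D := fun v hv => by
          rw [Function.update_of_ne]
          rintro rfl
          exact hs hv
        have := (hf.congr hE).insert (a := s) (by simpa using hs')
        simpa using this
      · intro v hv
        by_cases hvs : v = s
        · subst hvs
          simpa using Or.inr h
        · simpa [hvs] using hm v (Finset.mem_of_mem_insert_of_ne hv hvs)
    by_cases h1 : s₁ = r
    · subst h1
      exact key D id (Set.bijOn_id _) hr fun _ _ => Or.inl rfl
    · have hs1 : s₁ ∈ D := hin s₁ (by simp) h.ne' h1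
      have hst : s ∉ t.support := ((Walk.cons_isPath_iff h t).1 hp).2
      -- The guard on `s₁` starts the shift along the rest of the path, and the guard on `s` fills
      -- the vacated `s₁`.
      obtain ⟨f, hf, hm⟩ := ih hp.of_cons (D.erase s₁) (by simp) (by simp [hr]) (by
        intro v hv hv1 hvr
        refine Finset.mem_erase.2 ⟨hv1, hin v (by simp [hv]) ?_ hvr⟩
        rintro rfl
        exact hst hv)
      rw [Finset.insert_erase hs1] at hf hm
      have := key _ f hf (by simp [h1]) hm
      rwa [Finset.insert_comm, Finset.insert_erase hs1] at this

/-- The start of a longest path ending at `w` is such a vertex. -/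
lemma exists_reachable_atMostOneNeighbour [Finite V] (hF : F.IsAcyclic) (w : V) :
    ∃ v, F.Reachable v w ∧ AtMostOneNeighbour F v := by
  classical
  have := Fintype.ofFinite V
  let P : ℕ → Prop := fun n => ∃ (a : V) (q : F.Walk a w), q.IsPath ∧ q.length = n
  have hbd : ∀ n, P n → n ≤ Fintype.card V := by
    rintro n ⟨a, q, hq, rfl⟩
    exact hq.length_lt.le
  have h0 : P 0 := ⟨w, Walk.nil, Walk.IsPath.nil, rfl⟩
  have hspec : P (Nat.findGreatest P (Fintype.card V)) := Nat.findGreatest_spec (hbd 0 h0) h0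
  have hmax : ∀ n, P n → n ≤ Nat.findGreatest P (Fintype.card V) :=
    fun n hn => Nat.le_findGreatest (hbd n hn) hn
  obtain ⟨a, q, hq, hlen⟩ := hspec
  rw [← hlen] at hmax
  have hend : ∀ y, F.Adj a y → y = q.snd := by
    intro y hy
    by_cases hmem : y ∈ q.support
    · exact hF.eq_snd_of_adj_start hq hy hmem
    · have := hmax _ ⟨y, Walk.cons hy.symm q, hq.cons hmem, rfl⟩
      simp at this
  exact ⟨a, ⟨q⟩, fun y z hy hz => (hend y hy).trans (hend z hz).symm⟩

lemma GuardMove.dominated {D D' : Finset V} (h : GuardMove T D D') {r : V} (hr : r ∈ D')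
    (hrD : r ∉ D) : ∃ x ∈ D, T.Adj x r := by
  obtain ⟨f, hf, hm⟩ := h
  obtain ⟨x, hx, rfl⟩ := hf.surjOn (Finset.mem_coe.2 hr)
  refine ⟨x, hx, (hm x hx).resolve_left fun he => hrD ?_⟩
  rw [he]
  exact hx

/-- A position-based strategy gives an m-eternal dominating set. -/
lemma isMEternalDominating_of_respond {α : Type*} (D : α → Finset V)
    (h : ∀ e r, ∃ e', GuardMove T (D e) (D e') ∧ r ∈ D e') (e : α) :
    IsMEternalDominating T (D e) := by
  choose next hmove hmem using h
  let τ : List V → α := fun l => l.rec e fun r _ e' => next e' r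
  refine ⟨fun l => D (τ l), rfl, ?_, fun l r => hmove (τ l) r, fun l r => hmem (τ l) r⟩
  intro l u hu
  exact (hmove (τ l) u).dominated (hmem (τ l) u) hu

/-- The upper bound for the m-eternal domination number by the weight of a spanning forest. -/
theorem ForestBound.exists_isMEternalDominating [Fintype V] {R J : Finset V}
    (h : ForestBound T Finset.univ F R J) (hT : T.IsAcyclic) :
    ∃ D, IsMEternalDominating T D ∧ D.card ≤ R.card + J.card := by
  classical
  have hF : F.IsAcyclic := hT.anti h.le
  let B : Finset V := Finset.univ.filter fun v => ¬ AtMostOneNeighbour F v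
  have hB : ∀ v, v ∈ B ↔ ¬ AtMostOneNeighbour F v := by simp [B]
  -- A state of the defence places the roaming guard of each component on a vertex of degree at most
  -- one.
  let A := {e : F.ConnectedComponent → V //
    ∀ c, F.connectedComponentMk (e c) = c ∧ AtMostOneNeighbour F (e c)}
  have hA : Nonempty A := by
    have : ∀ c : F.ConnectedComponent, ∃ v, F.connectedComponentMk v = c ∧
        AtMostOneNeighbour F v := by
      intro c
      induction c using ConnectedComponent.ind with
      | _ w =>
        obtain ⟨v, hv, hone⟩ := exists_reachable_atMostOneNeighbour hF w
        exact ⟨v, ConnectedComponent.sound hv, hone⟩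
    choose e he using this
    exact ⟨e, he⟩
  let D : A → Finset V := fun e => B ∪ Finset.univ.image e.1
  have hinj : ∀ e : A, Function.Injective e.1 := by
    intro e c c' hcc
    rw [← (e.2 c).1, ← (e.2 c').1, hcc]
  have hrespond : ∀ e r, ∃ e', GuardMove T (D e) (D e') ∧ r ∈ D e' := by
    intro e r
    by_cases hr : r ∈ D e
    · exact ⟨e, GuardMove.refl _, hr⟩
    · have hr1 : AtMostOneNeighbour F r := by
        by_contra hcon
        exact hr (Finset.mem_union_left _ ((hB r).2 hcon))
      have hre : ∀ c, e.1 c ≠ r := by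
        rintro c rfl
        exact hr (Finset.mem_union_right _ (Finset.mem_image_of_mem _ (Finset.mem_univ _)))
      let c := F.connectedComponentMk r
      let e' : A := ⟨Function.update e.1 c r, fun d => by
        by_cases hd : d = c
        · subst hd
          simp [c, hr1]
        · rw [Function.update_of_ne hd]
          exact e.2 d⟩
      let D₀ := B ∪ (Finset.univ.erase c).image e.1
      have hD : D e = insert (e.1 c) D₀ := by
        ext v
        simp only [D, D₀, Finset.mem_union, Finset.mem_image, Finset.mem_univ, true_and,
          Finset.mem_insert, Finset.mem_erase, and_true]
        constructor
        · rintro (h | ⟨d, rfl⟩)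
          · exact Or.inr (Or.inl h)
          · by_cases hd : d = c
            · exact Or.inl (hd ▸ rfl)
            · exact Or.inr (Or.inr ⟨d, hd, rfl⟩)
        · rintro (rfl | h | ⟨d, -, rfl⟩)
          · exact Or.inr ⟨c, rfl⟩
          · exact Or.inl h
          · exact Or.inr ⟨d, rfl⟩
      have hD' : D e' = insert r D₀ := by
        ext v
        simp only [D, D₀, e', Finset.mem_union, Finset.mem_image, Finset.mem_univ, true_and,
          Finset.mem_insert, Finset.mem_erase, and_true]
        constructor
        · rintro (h | ⟨d, rfl⟩)
          · exact Or.inr (Or.inl h)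
          · by_cases hd : d = c
            · exact Or.inl (by simp [hd])
            · exact Or.inr (Or.inr ⟨d, hd, by simp [hd]⟩)
        · rintro (rfl | h | ⟨d, hd, rfl⟩)
          · exact Or.inr ⟨c, by simp⟩
          · exact Or.inl h
          · exact Or.inr ⟨d, by simp [hd]⟩
      refine ⟨e', ?_, by rw [hD']; simp⟩
      rw [hD, hD']
      obtain ⟨p, hp⟩ := (ConnectedComponent.exact (e.2 c).1).exists_isPath
      refine (guardMove_insert_of_isPath p hp D₀ ?_ ?_ ?_).mono h.le
      · intro hmem
        rcases Finset.mem_union.1 hmem with hm | hm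
        · exact (hB _).1 hm (e.2 c).2
        · obtain ⟨d, hd, hdc⟩ := Finset.mem_image.1 hm
          exact (Finset.mem_erase.1 hd).1 (hinj e hdc)
      · intro hmem
        exact hr (hD ▸ Finset.mem_insert_of_mem hmem)
      · intro v hv hvs hvr
        exact Finset.mem_union_left _ ((hB v).2 (not_atMostOneNeighbour_of_mem_support p hp hv hvs hvr))
  obtain ⟨e⟩ := hA
  refine ⟨D e, isMEternalDominating_of_respond D hrespond e, ?_⟩
  have h1 : B.card ≤ J.card := by
    refine Finset.card_le_card fun v hv => ?_
    by_contra hvJ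
    exact (hB v).1 hv (h.branch v hvJ)
  have h2 : (Finset.univ.image e.1).card ≤ R.card := by
    refine Finset.card_image_le.trans ?_
    have : (Finset.univ : Finset F.ConnectedComponent) ⊆ R.image F.connectedComponentMk := by
      intro c _
      induction c using ConnectedComponent.ind with
      | _ w =>
        obtain ⟨r, hr, hrw⟩ := h.cover w (Finset.mem_univ _)
        exact Finset.mem_image.2 ⟨r, hr, ConnectedComponent.sound hrw⟩
    exact (Finset.card_le_card this).trans Finset.card_image_le
  have := Finset.card_union_le B (Finset.univ.image e.1)
  simp only [D]
  omega

end UpperBound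

/-! ### The connected domination number as the number of non-leaves -/

section ConnectedDomination

variable {V : Type*} {T : SimpleGraph V}

lemma isLeaf_iff {v : V} : IsLeaf T v ↔ ∃ a, T.Adj v a ∧ ∀ b, T.Adj v b → b = a := by
  rw [IsLeaf, Set.ncard_eq_one]
  constructor
  · rintro ⟨a, ha⟩
    refine ⟨a, ?_, fun b hb => ?_⟩
    · have : a ∈ T.neighborSet v := by rw [ha]; rfl
      exact this
    · have : b ∈ T.neighborSet v := hb
      rwa [ha] at this
  · rintro ⟨a, ha, h⟩
    exact ⟨a, Set.eq_singleton_iff_unique_mem.2 ⟨ha, h⟩⟩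

lemma IsLeaf.atMostOneNeighbour {v : V} (h : IsLeaf T v) : AtMostOneNeighbour T v := by
  obtain ⟨a, -, ha⟩ := isLeaf_iff.1 h
  exact fun b c hb hc => (ha b hb).trans (ha c hc).symm

lemma exists_adj_of_connected (hT : T.Connected) (hV : 2 ≤ Nat.card V) (v : V) :
    ∃ a, T.Adj v a := by
  have : Nontrivial V := by
    have : Finite V := Nat.finite_of_card_ne_zero (by omega)
    exact Finite.one_lt_card_iff_nontrivial.1 hV
  exact hT.preconnected.exists_adj_of_nontrivial v

lemma exists_adj_ne_of_not_isLeaf (hT : T.Connected) (hV : 2 ≤ Nat.card V) {v : V}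
    (h : ¬ IsLeaf T v) : ∃ a b, a ≠ b ∧ T.Adj v a ∧ T.Adj v b := by
  obtain ⟨a, ha⟩ := exists_adj_of_connected hT hV v
  by_contra hcon
  push Not at hcon
  refine h (isLeaf_iff.2 ⟨a, ha, fun b hb => ?_⟩)
  by_contra hne
  exact hcon b a hne hb ha

/-- The set of vertices that are not leaves. -/
noncomputable def nonLeaves [Finite V] (T : SimpleGraph V) : Finset V :=
  (Set.toFinite {v | ¬ IsLeaf T v}).toFinset

@[simp] lemma mem_nonLeaves [Finite V] {v : V} : v ∈ nonLeaves T ↔ ¬ IsLeaf T v := by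
  simp [nonLeaves]

lemma mem_of_reachable_of_closed {X : Set V} (hX : ∀ x ∈ X, ∀ y, T.Adj x y → y ∈ X) {a b : V}
    (ha : a ∈ X) (h : T.Reachable a b) : b ∈ X := by
  obtain ⟨p⟩ := h
  induction p with
  | nil => exact ha
  | cons h _ ih => exact ih (hX _ ha _ h)

lemma eq_or_eq_of_reachable {u w : V} (hu : ∀ y, T.Adj u y → y = w)
    (hw : ∀ y, T.Adj w y → y = u) {x : V} (h : T.Reachable u x) : x = u ∨ x = w := by
  refine mem_of_reachable_of_closed (X := {z | z = u ∨ z = w}) ?_ (Or.inl rfl) h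
  rintro z (rfl | rfl) y hy
  · exact Or.inr (hu y hy)
  · exact Or.inl (hw y hy)

lemma not_isLeaf_of_adj_isLeaf [Finite V] (hT : T.Connected) (hV : 3 ≤ Nat.card V) {u w : V}
    (huw : T.Adj u w) (hu : IsLeaf T u) : ¬ IsLeaf T w := by
  classical
  intro hw
  have hu' := hu.atMostOneNeighbour
  have hw' := hw.atMostOneNeighbour
  have hall : ∀ x, T.Reachable u x → x = u ∨ x = w := fun x =>
    eq_or_eq_of_reachable (fun y hy => hu' _ _ hy huw) (fun y hy => hw' _ _ hy huw.symm)
  have := Fintype.ofFinite V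
  have hsub : (Finset.univ : Finset V) ⊆ {u, w} := fun x _ => by
    simpa using hall x (hT.preconnected u x)
  have := (Finset.card_le_card hsub).trans Finset.card_le_two
  rw [Finset.card_univ, ← Nat.card_eq_fintype_card] at this
  omega

/-- If a non-leaf `v` is outside `D`, two of its neighbours reach `D` by walks avoiding `v`, and
connectedness of `D` joins these into a walk avoiding `v`. This contradicts uniqueness of the path
between the two neighbours, which runs through `v`. -/
lemma IsConnectedDominating.nonLeaves_subset [Finite V] (hT : T.IsTree) (hV : 2 ≤ Nat.card V)
    {D : Finset V} (hD : IsConnectedDominating T D) : nonLeaves T ⊆ D := by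
  classical
  intro v hv
  by_contra hvD
  obtain ⟨a, b, hab, hva, hvb⟩ := exists_adj_ne_of_not_isLeaf hT.connected hV (mem_nonLeaves.1 hv)
  have hdom : ∀ x, T.Adj v x → ∃ d, ∃ _ : d ∈ D, ∃ q : T.Walk x d, v ∉ q.support := by
    intro x hvx
    by_cases hx : x ∈ D
    · exact ⟨x, hx, Walk.nil, by simpa using hvx.ne⟩
    · obtain ⟨d, hd, hdx⟩ := hD.1 x hx
      refine ⟨d, hd, Walk.cons hdx.symm Walk.nil, ?_⟩
      have : v ≠ d := fun h => hvD (h ▸ hd)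
      simp [hvx.ne, this]
  obtain ⟨d, hd, q, hq⟩ := hdom a hva
  obtain ⟨d', hd', q', hq'⟩ := hdom b hvb
  obtain ⟨p⟩ := hD.2.preconnected ⟨d, hd⟩ ⟨d', hd'⟩
  have hp : v ∉ (p.map (Embedding.induce (D : Set V)).toHom).support := by
    rw [Walk.support_map]
    intro hmem
    obtain ⟨y, -, hy⟩ := List.mem_map.1 hmem
    exact hvD (hy ▸ y.2)
  let W : T.Walk a b := q.append ((p.map (Embedding.induce (D : Set V)).toHom).append q'.reverse)
  have hW : v ∉ W.support := by
    intro hmem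
    rcases (Walk.mem_support_append_iff _ _).1 hmem with h | h
    · exact hq h
    rcases (Walk.mem_support_append_iff _ _).1 h with h | h
    · exact hp h
    · have h' : v ∈ (q'.reverse).support := h
      rw [Walk.support_reverse, List.mem_reverse] at h'
      exact hq' h'
  have hP : (Walk.cons hva.symm (Walk.cons hvb Walk.nil)).IsPath := by
    simp [hab, hva.ne', hvb.ne]
  have := (hT.isAcyclic.subsingleton_path a b).elim ⟨_, hP⟩ W.toPath
  have hs : (Walk.cons hva.symm (Walk.cons hvb Walk.nil)).support = W.bypass.support :=
    congrArg (fun P : T.Path a b => P.1.support) this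
  refine hW (W.support_bypass_subset_support ?_)
  rw [← hs]
  simp

lemma isConnectedDominating_univ [Fintype V] (hT : T.Connected) :
    IsConnectedDominating T Finset.univ := by
  refine ⟨fun u hu => absurd (Finset.mem_univ u) hu, ?_⟩
  rw [Finset.coe_univ]
  exact (induceUnivIso T).connected_iff.2 hT

lemma card_nonLeaves_le_connectedDominationNumber [Finite V] (hT : T.IsTree)
    (hV : 2 ≤ Nat.card V) : (nonLeaves T).card ≤ connectedDominationNumber T := by
  have := Fintype.ofFinite V
  obtain ⟨D, hD, hcard⟩ := Nat.sInf_mem (s := {k | ∃ D : Finset V, IsConnectedDominating T D ∧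
    D.card = k}) ⟨_, _, isConnectedDominating_univ hT.connected, rfl⟩
  rw [connectedDominationNumber, ← hcard]
  exact Finset.card_le_card (hD.nonLeaves_subset hT hV)

lemma connectedDominationNumber_pos [Finite V] (hT : T.IsTree) :
    0 < connectedDominationNumber T := by
  have := Fintype.ofFinite V
  obtain ⟨D, hD, hcard⟩ := Nat.sInf_mem (s := {k | ∃ D : Finset V, IsConnectedDominating T D ∧
    D.card = k}) ⟨_, _, isConnectedDominating_univ hT.connected, rfl⟩
  rw [connectedDominationNumber, ← hcard, Finset.card_pos]
  obtain ⟨x⟩ := hD.2.nonempty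
  exact ⟨x.1, x.2⟩

/-- Leaves hang on non-leaves, and a path meets leaves only at its ends. In K₂ there are no
non-leaves, whence the assumption of three vertices. -/
lemma connectedDominationNumber_le_card_nonLeaves [Finite V] (hT : T.IsTree)
    (hV : 3 ≤ Nat.card V) : connectedDominationNumber T ≤ (nonLeaves T).card := by
  refine Nat.sInf_le ⟨nonLeaves T, ⟨?_, ?_⟩, rfl⟩
  · intro u hu
    rw [mem_nonLeaves, not_not] at hu
    obtain ⟨a, ha, -⟩ := isLeaf_iff.1 hu
    exact ⟨a, mem_nonLeaves.2 (not_isLeaf_of_adj_isLeaf hT.connected hV ha hu), ha.symm⟩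
  · have hne : ∃ v, v ∈ nonLeaves T := by
      obtain ⟨u⟩ := hT.connected.nonempty
      by_cases hu : IsLeaf T u
      · obtain ⟨a, ha, -⟩ := isLeaf_iff.1 hu
        exact ⟨a, mem_nonLeaves.2 (not_isLeaf_of_adj_isLeaf hT.connected hV ha hu)⟩
      · exact ⟨u, mem_nonLeaves.2 hu⟩
    obtain ⟨v, hv⟩ := hne
    have : Nonempty ((nonLeaves T : Finset V) : Set V) := ⟨⟨v, hv⟩⟩
    refine ⟨?_⟩
    rintro ⟨a, ha⟩ ⟨b, hb⟩
    obtain ⟨p, hp⟩ := (hT.connected.preconnected a b).exists_isPath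
    refine ⟨p.induce _ fun x hx => ?_⟩
    by_cases hxa : x = a
    · exact hxa ▸ ha
    by_cases hxb : x = b
    · exact hxb ▸ hb
    exact Finset.mem_coe.2 (mem_nonLeaves.2 fun hl =>
      not_atMostOneNeighbour_of_mem_support p hp hx hxa hxb hl.atMostOneNeighbour)

lemma exists_isMEternalDominating_card_eq [Finite V] (T : SimpleGraph V) :
    ∃ D, IsMEternalDominating T D ∧ D.card = mEternalDominationNumber T := by
  have := Fintype.ofFinite V
  refine Nat.sInf_mem (s := {k | ∃ D : Finset V, IsMEternalDominating T D ∧ D.card = k})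
    ⟨_, Finset.univ, ?_, rfl⟩
  exact isMEternalDominating_of_respond (fun _ : Unit => Finset.univ)
    (fun _ r => ⟨(), GuardMove.refl _, Finset.mem_univ r⟩) ()

end ConnectedDomination

/-! ### From a light forest to loner leaves -/

section Forward

variable {V : Type*} {F T : SimpleGraph V}

lemma eq_of_reachable_of_isolated {x u : V} (hx : ∀ y, ¬ F.Adj x y) (h : F.Reachable x u) :
    u = x := by
  obtain ⟨p⟩ := h
  cases p with
  | nil => rfl
  | cons h _ => exact absurd h (hx _)

/-- An isolated vertex of a forest can be attached to a neighbour at no cost. -/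
lemma ForestBound.attach_isolated [Fintype V] [DecidableEq V] {R J : Finset V}
    (h : ForestBound T Finset.univ F R J) {x y : V} (hx : ∀ z, ¬ F.Adj x z) (hxy : T.Adj x y) :
    ForestBound T Finset.univ (F ⊔ restrict T {x, y}) (R.erase x) (insert y J) ∧
      (R.erase x).card + (insert y J).card ≤ R.card + J.card := by
  have hy : ∃ r ∈ R, r ≠ x ∧ F.Reachable r y := by
    obtain ⟨r, hr, hry⟩ := h.cover y (Finset.mem_univ _)
    refine ⟨r, hr, ?_, hry⟩
    rintro rfl
    exact hxy.ne (eq_of_reachable_of_isolated hx hry).symm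
  have hxR : x ∈ R := by
    obtain ⟨r, hr, hrx⟩ := h.cover x (Finset.mem_univ _)
    exact eq_of_reachable_of_isolated hx hrx.symm ▸ hr
  have hadj : (F ⊔ restrict T {x, y}).Adj y x := Or.inr ⟨hxy.symm, by simp, by simp⟩
  refine ⟨⟨sup_le h.le (restrict_le _ _), ?_, ?_⟩, ?_⟩
  · intro u _
    obtain ⟨r, hr, hru⟩ := h.cover u (Finset.mem_univ _)
    by_cases hrx : r = x
    · subst hrx
      obtain ⟨r', hr', hne, hr'y⟩ := hy
      rw [eq_of_reachable_of_isolated hx hru]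
      exact ⟨r', Finset.mem_erase.2 ⟨hne, hr'⟩, (hr'y.mono le_sup_left).trans hadj.reachable⟩
    · exact ⟨r, Finset.mem_erase.2 ⟨hrx, hr⟩, hru.mono le_sup_left⟩
  · intro v hv a b hva hvb
    rw [Finset.mem_insert, not_or] at hv
    have key : ∀ c, (F ⊔ restrict T {x, y}).Adj v c → F.Adj v c ∨ (v = x ∧ c = y) := by
      rintro c (hc | ⟨hc, h1, h2⟩)
      · exact Or.inl hc
      · have := hc.ne
        simp only [Finset.mem_insert, Finset.mem_singleton] at h1 h2
        grind
    rcases key a hva with ha | ha <;> rcases key b hvb with hb | hb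
    · exact h.branch v hv.2 a b ha hb
    · exact absurd (hb.1 ▸ ha) (hx a)
    · exact absurd (ha.1 ▸ hb) (hx b)
    · rw [ha.2, hb.2]
  · have h1 := Finset.card_erase_add_one hxR
    have h2 := Finset.card_insert_le y J
    omega

/-- A forest of given weight can be chosen without isolated vertices. -/
lemma ForestBound.exists_no_isolated [Fintype V] {R J : Finset V} {m : ℕ}
    (h : ForestBound T Finset.univ F R J) (hm : R.card + J.card ≤ m)
    (hT : ∀ v, ∃ a, T.Adj v a) :
    ∃ F R J, ForestBound T Finset.univ F R J ∧ R.card + J.card ≤ m ∧ ∀ v, ∃ a, F.Adj v a := by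
  classical
  -- In a maximal forest within the weight bound, an isolated vertex could still be attached.
  obtain ⟨F', ⟨R', J', h', hm'⟩, hmax⟩ := (Set.toFinite {F : SimpleGraph V | ∃ R J,
    ForestBound T Finset.univ F R J ∧ R.card + J.card ≤ m}).exists_maximal ⟨F, R, J, h, hm⟩
  refine ⟨F', R', J', h', hm', fun x => ?_⟩
  by_contra hx
  push Not at hx
  obtain ⟨y, hxy⟩ := hT x
  obtain ⟨h1, h2⟩ := h'.attach_isolated hx hxy
  have hle := hmax ⟨_, _, h1, h2.trans hm'⟩ le_sup_left
  exact hx y (hle (Or.inr ⟨hxy, by simp, by simp⟩))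

lemma two_le_ncard_supp [Finite V] (hF : ∀ v, ∃ a, F.Adj v a) (c : F.ConnectedComponent) :
    2 ≤ c.supp.ncard := by
  induction c using ConnectedComponent.ind with
  | _ v =>
    obtain ⟨a, ha⟩ := hF v
    refine (Set.one_lt_ncard (Set.toFinite _)).2 ⟨v, rfl, a, ?_, ha.ne⟩
    exact ConnectedComponent.sound ha.symm.reachable

lemma isSpanningForestOfType [Finite V] (hle : F ≤ T) (hT : T.IsAcyclic)
    (hF : ∀ v, ∃ a, F.Adj v a) :
    IsSpanningForestOfType T F {c : F.ConnectedComponent | c.supp.ncard = 2}.ncard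
      {c : F.ConnectedComponent | 3 ≤ c.supp.ncard}.ncard := by
  refine ⟨hle, hT.anti hle, fun c => ?_, rfl, rfl⟩
  have := two_le_ncard_supp hF c
  omega

/-- A forest without isolated vertices whose weight is at most the number of vertices which are
not leaves has at least as many leaves which are loners as it has large components. -/
lemma ForestBound.card_large_le [Fintype V] {R J : Finset V}
    (h : ForestBound T Finset.univ F R J) (hF : ∀ v, ∃ a, F.Adj v a)
    (hcard : R.card + J.card ≤ (nonLeaves T).card) :
    {c : F.ConnectedComponent | 3 ≤ c.supp.ncard}.ncard ≤
      {v : V | IsLoner T v ∧ IsLeaf F v}.ncard := by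
  classical
  have hcomp : {c : F.ConnectedComponent | c.supp.ncard = 2}.ncard +
      {c : F.ConnectedComponent | 3 ≤ c.supp.ncard}.ncard ≤ R.card := by
    rw [← Set.ncard_union_eq (by
      rw [Set.disjoint_left]
      intro c hc hc'
      simp only [Set.mem_ofPred_eq] at hc hc'
      omega) (Set.toFinite _) (Set.toFinite _)]
    have hsub : {c : F.ConnectedComponent | c.supp.ncard = 2} ∪
        {c : F.ConnectedComponent | 3 ≤ c.supp.ncard} ⊆
        (F.connectedComponentMk '' (R : Set V)) := by
      intro c _
      induction c using ConnectedComponent.ind with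
      | _ w =>
        obtain ⟨r, hr, hrw⟩ := h.cover w (Finset.mem_univ _)
        exact ⟨r, hr, ConnectedComponent.sound hrw⟩
    refine (Set.ncard_le_ncard hsub (Set.toFinite _)).trans ?_
    refine (Set.ncard_image_le (Set.toFinite _)).trans ?_
    rw [Set.ncard_coe_finset]
  -- By the weight bound these are at least `R.card` vertices, and all of them are leaves of `F`.
  let N : Set V := {v | ¬ IsLeaf T v ∧ v ∉ J}
  have hN : R.card ≤ N.ncard := by
    have : N = ((nonLeaves T \ J : Finset V) : Set V) := by
      ext v; simp [N]
    rw [this, Set.ncard_coe_finset]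
    have := Finset.le_card_sdiff J (nonLeaves T)
    omega
  have hleaf : ∀ v ∈ N, IsLeaf F v := by
    intro v hv
    obtain ⟨a, ha⟩ := hF v
    exact isLeaf_iff.2 ⟨a, ha, fun b hb => h.branch v hv.2 b a hb ha⟩
  have hsupp : ∀ v ∈ {v ∈ N | ¬ IsLoner T v}, ∃ w, IsLeaf T w ∧ w ≠ v ∧
      (F.connectedComponentMk v).supp = {v, w} := by
    rintro v ⟨hv, hl⟩
    obtain ⟨w, hvw, hw⟩ : ∃ w, T.Adj v w ∧ IsLeaf T w := by
      by_contra hcon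
      push Not at hcon
      exact hl ⟨hv.1, hcon⟩
    -- The leaf `w` of `T` is not isolated in `F`, so it is joined to `v` there, and `v` has no
    -- second neighbour in `F`.
    have hw1 : ∀ y, F.Adj w y → y = v := fun y hy =>
      hw.atMostOneNeighbour _ _ (h.le hy) hvw.symm
    obtain ⟨v', hv'⟩ := hF w
    have hvw' : F.Adj v w := (hw1 v' hv' ▸ hv').symm
    refine ⟨w, hw, hvw.ne', ?_⟩
    ext y
    constructor
    · intro hy
      have hy' : F.Reachable v y := (ConnectedComponent.exact hy).symm
      exact eq_or_eq_of_reachable (fun z hz => h.branch v hv.2 z w hz hvw') hw1 hy'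
    · rintro (rfl | rfl)
      · rfl
      · exact ConnectedComponent.sound hvw'.symm.reachable
  have h1 : {v ∈ N | ¬ IsLoner T v}.ncard ≤
      {c : F.ConnectedComponent | c.supp.ncard = 2}.ncard := by
    refine Set.ncard_le_ncard_of_injOn F.connectedComponentMk ?_ ?_ (Set.toFinite _)
    · intro v hv
      obtain ⟨w, -, hne, hs⟩ := hsupp v hv
      rw [Set.mem_ofPred_eq, hs, Set.ncard_pair hne.symm]
    · intro v hv v' hv' heq
      obtain ⟨w, hw, -, hs⟩ := hsupp v hv
      have hmem : v' ∈ (F.connectedComponentMk v).supp := heq.symm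
      rw [hs] at hmem
      rcases hmem with h' | h'
      · exact h'.symm
      -- The partner of `v` in its pair is a leaf of `T`, so it is not in `N`.
      · exact absurd (h' ▸ hw) hv'.1.1
  have h2 : N.ncard ≤ {v : V | IsLoner T v ∧ IsLeaf F v}.ncard +
      {v ∈ N | ¬ IsLoner T v}.ncard := by
    refine (Set.ncard_le_ncard (t := {v : V | IsLoner T v ∧ IsLeaf F v} ∪
      {v ∈ N | ¬ IsLoner T v}) ?_ (Set.toFinite _)).trans (Set.ncard_union_le _ _)
    intro v hv
    by_cases hl : IsLoner T v
    · exact Or.inl ⟨hl, hleaf v hv⟩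
    · exact Or.inr ⟨hv, hl⟩
  omega

end Forward

/-! ### Connected vertex sets of a tree and the pieces left after a deletion -/

section Pieces

variable {V : Type*} {G F T : SimpleGraph V}

/-- The vertex set `X` induces a preconnected subgraph of `T`. -/
def ConnectedOn (T : SimpleGraph V) (X : Finset V) : Prop :=
  ∀ a ∈ X, ∀ b ∈ X, (restrict T X).Reachable a b

/-- `C` is the vertex set of a component of the subgraph of `T` induced by `Z`. -/
structure IsPiece (T : SimpleGraph V) (Z C : Finset V) : Prop where
  subset : C ⊆ Z
  nonempty : C.Nonempty
  connected : ConnectedOn T C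
  closed : ∀ a ∈ C, ∀ b ∈ Z, T.Adj a b → b ∈ C

lemma restrict_mono {G H : SimpleGraph V} {X Y : Finset V} (h : G ≤ H) (hXY : X ⊆ Y) :
    restrict G X ≤ restrict H Y :=
  fun _ _ hab => ⟨h hab.1, hXY hab.2.1, hXY hab.2.2⟩

lemma reachable_restrict_of_closed {X : Finset V} (hX : ∀ x ∈ X, ∀ y, G.Adj x y → y ∈ X) {a b : V}
    (ha : a ∈ X) (h : G.Reachable a b) : (restrict G X).Reachable a b := by
  obtain ⟨p⟩ := h
  induction p with
  | nil => exact Reachable.refl _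
  | cons h _ ih =>
    have := hX _ ha _ h
    exact (Adj.reachable (G := restrict G X) ⟨h, ha, this⟩).trans (ih this)

lemma ConnectedOn.of_forall_reachable {X : Finset V} {x : V}
    (h : ∀ a ∈ X, (restrict T X).Reachable a x) : ConnectedOn T X :=
  fun a ha b hb => (h a ha).trans (h b hb).symm

lemma ConnectedOn.insert_of_adj [DecidableEq V] {C : Finset V} {u a : V} (hC : ConnectedOn T C)
    (ha : a ∈ C) (hua : T.Adj u a) : ConnectedOn T (insert u C) := by
  refine ConnectedOn.of_forall_reachable (x := a) fun b hb => ?_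
  rcases Finset.mem_insert.1 hb with rfl | hb
  · exact Adj.reachable (G := restrict T _) ⟨hua, by simp, by simp [ha]⟩
  · exact (hC b hb a ha).mono (restrict_mono le_rfl (Finset.subset_insert _ _))

lemma exists_isPiece [DecidableEq V] {Z : Finset V} {z : V} (hz : z ∈ Z) :
    ∃ C, IsPiece T Z C ∧ z ∈ C := by
  classical
  let C := Z.filter fun w => (restrict T Z).Reachable z w
  have hmem : ∀ w, w ∈ C ↔ w ∈ Z ∧ (restrict T Z).Reachable z w := by simp [C]
  have hzC : z ∈ C := (hmem z).2 ⟨hz, Reachable.refl _⟩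
  have hclosed : ∀ x ∈ C, ∀ y, (restrict T Z).Adj x y → y ∈ C := fun x hx y hxy =>
    (hmem y).2 ⟨hxy.2.2, ((hmem x).1 hx).2.trans hxy.reachable⟩
  refine ⟨C, ⟨Finset.filter_subset _ _, ⟨z, hzC⟩, ?_, ?_⟩, hzC⟩
  · refine ConnectedOn.of_forall_reachable (x := z) fun a ha => ?_
    exact ((reachable_restrict_of_closed hclosed hzC ((hmem a).1 ha).2).mono
      (restrict_mono (restrict_le _ _) subset_rfl)).symm
  · intro a ha b hb hab
    exact hclosed a ha b ⟨hab, ((hmem a).1 ha).1, hb⟩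

lemma IsPiece.of_sdiff [DecidableEq V] {Z C C' : Finset V} (hC : IsPiece T Z C)
    (hC' : IsPiece T (Z \ C) C') : IsPiece T Z C' := by
  refine ⟨hC'.subset.trans Finset.sdiff_subset, hC'.nonempty, hC'.connected, ?_⟩
  intro a ha b hb hab
  refine hC'.closed a ha b (Finset.mem_sdiff.2 ⟨hb, fun hbC => ?_⟩) hab
  have ha' := Finset.mem_sdiff.1 (hC'.subset ha)
  exact ha'.2 (hC.closed b hbC a ha'.1 hab.symm)

lemma IsPiece.subset_of_mem {Z C Y : Finset V} (hC : IsPiece T Z C) (hY : ConnectedOn T Y)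
    (hYZ : Y ⊆ Z) {y : V} (hy : y ∈ Y) (hyC : y ∈ C) : Y ⊆ C := by
  intro w hw
  exact mem_of_reachable_of_closed (T := restrict T Y) (X := (C : Set V))
    (fun x hx z hxz => hC.closed x hx z (hYZ hxz.2.2) hxz.1) hyC (hY y hy w hw)

/-- Every edge of an acyclic graph is a bridge, and `H` lacks this one. -/
lemma not_reachable_of_le {H : SimpleGraph V} (hT : T.IsAcyclic) (hH : H ≤ T) {x y : V}
    (hxy : T.Adj x y) (hn : ¬ H.Adj x y) : ¬ H.Reachable x y := by
  intro hr
  have hb := isAcyclic_iff_forall_adj_isBridge.1 hT hxy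
  rw [isBridge_iff] at hb
  refine hb (hr.mono ?_)
  intro a b hab
  rw [deleteEdges_adj]
  refine ⟨hH hab, ?_⟩
  intro h
  rcases Sym2.eq_iff.1 (Set.mem_singleton_iff.1 h) with ⟨rfl, rfl⟩ | ⟨rfl, rfl⟩
  · exact hn hab
  · exact hn hab.symm

/-- There is at most one edge between two disjoint connected sets of an acyclic graph. -/
lemma ConnectedOn.eq_and_eq_of_adj {X Y : Finset V} (hT : T.IsAcyclic) (hX : ConnectedOn T X)
    (hY : ConnectedOn T Y) (hXY : Disjoint X Y) {x a y b : V} (hx : x ∈ X) (ha : a ∈ X)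
    (hy : y ∈ Y) (hb : b ∈ Y) (hxy : T.Adj x y) (hab : T.Adj a b) : x = a ∧ y = b := by
  by_contra hne
  have hd := Finset.disjoint_left.1 hXY
  have hXY' : ∀ {z}, z ∈ X → z ∈ Y → False := fun h1 h2 => hd h1 h2
  -- If the edges differ, this graph joins `x` to `y` without using the edge between them.
  let H : SimpleGraph V := restrict T X ⊔ restrict T Y ⊔ SimpleGraph.edge a b
  have hHT : H ≤ T := by
    refine sup_le (sup_le (restrict_le _ _) (restrict_le _ _)) ?_
    intro c d hcd
    rw [edge_adj] at hcd
    rcases hcd.1 with ⟨rfl, rfl⟩ | ⟨rfl, rfl⟩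
    · exact hab
    · exact hab.symm
  refine not_reachable_of_le hT hHT hxy ?_ ?_
  · rintro ((h | h) | h)
    · exact hXY' h.2.2 hy
    · exact hXY' hx h.2.1
    · rw [edge_adj] at h
      rcases h.1 with ⟨h1, h2⟩ | ⟨h1, h2⟩
      · exact hne ⟨h1, h2⟩
      · exact hXY' hx (h1 ▸ hb)
  · refine (((hX x hx a ha).mono ?_).trans (Adj.reachable ?_)).trans ((hY b hb y hy).mono ?_)
    · exact le_sup_left.trans le_sup_left
    · exact Or.inr ((edge_adj ..).2 ⟨Or.inl ⟨rfl, rfl⟩, hab.ne⟩)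
    · exact le_sup_right.trans le_sup_left

lemma connectedOn_singleton (u : V) : ConnectedOn T {u} := by
  intro a ha b hb
  rw [Finset.mem_singleton.1 ha, Finset.mem_singleton.1 hb]

lemma exists_adj_of_reachable {X : Set V} {a b : V} (h : G.Reachable a b) (ha : a ∈ X)
    (hb : b ∉ X) : ∃ x ∈ X, ∃ y, y ∉ X ∧ G.Adj x y := by
  by_contra hcon
  push Not at hcon
  exact hb (mem_of_reachable_of_closed (fun x hx y hxy => by
    by_contra hy
    exact hcon x hx y hy hxy) ha h)

/-- Deleting a component of `A \ P`, where `P` is connected, keeps `A` connected. -/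
lemma ConnectedOn.sdiff_isPiece [DecidableEq V] {A P C : Finset V} (hA : ConnectedOn T A)
    (hP : ConnectedOn T P) (hPA : P ⊆ A) (hne : P.Nonempty) (hC : IsPiece T (A \ P) C) :
    ConnectedOn T (A \ C) := by
  obtain ⟨x, hx⟩ := hne
  have hPC : P ⊆ A \ C := fun y hy => Finset.mem_sdiff.2
    ⟨hPA hy, fun hyC => (Finset.mem_sdiff.1 (hC.subset hyC)).2 hy⟩
  refine ConnectedOn.of_forall_reachable (x := x) fun a ha => ?_
  obtain ⟨p⟩ := hA a (Finset.mem_sdiff.1 ha).1 x (hPA hx)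
  induction p with
  | nil => exact Reachable.refl _
  | @cons a b x h t ih =>
    by_cases haP : a ∈ P
    · exact (hP a haP x hx).mono (restrict_mono le_rfl hPC)
    · have hbC : b ∉ C := fun hbC => (Finset.mem_sdiff.1 ha).2
        (hC.closed b hbC a (Finset.mem_sdiff.2 ⟨h.2.1, haP⟩) h.1.symm)
      have hb : b ∈ A \ C := Finset.mem_sdiff.2 ⟨h.2.2, hbC⟩
      exact (Adj.reachable (G := restrict T (A \ C)) ⟨h.1, ha, hb⟩).trans (ih hx hb)

end Pieces

/-! ### Excess of a vertex set -/

section Excess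

variable {V : Type*} [Finite V] [DecidableEq V] {F T : SimpleGraph V} {X Y : Finset V}

/-- Some forest on `X` has weight exceeding by at most `d` the number of vertices of `X` which
are not leaves of `T`. -/
def ExcessLE (T : SimpleGraph V) (X : Finset V) (d : ℤ) : Prop :=
  ∃ F R J, ForestBound (restrict T X) X F R J ∧
    (R.card : ℤ) + J.card ≤ (nonLeaves T ∩ X).card + d

lemma ExcessLE.mono {d e : ℤ} (h : ExcessLE T X d) (hde : d ≤ e) : ExcessLE T X e := by
  obtain ⟨F, R, J, hF, hc⟩ := h
  exact ⟨F, R, J, hF, by omega⟩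

lemma excessLE_empty : ExcessLE T ∅ 0 :=
  ⟨⊥, ∅, ∅, ⟨bot_le, by simp, fun v _ a b h => absurd h (by simp)⟩, by simp⟩

lemma ExcessLE.union {d e : ℤ} (hX : ExcessLE T X d) (hY : ExcessLE T Y e) (hXY : Disjoint X Y) :
    ExcessLE T (X ∪ Y) (d + e) := by
  obtain ⟨F, R, J, hF, hc⟩ := hX
  obtain ⟨F', R', J', hF', hc'⟩ := hY
  refine ⟨F ⊔ F', R ∪ R', J ∪ J', ⟨sup_le (hF.le.trans ?_) (hF'.le.trans ?_), ?_, ?_⟩, ?_⟩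
  · exact restrict_mono le_rfl Finset.subset_union_left
  · exact restrict_mono le_rfl Finset.subset_union_right
  · intro u hu
    rcases Finset.mem_union.1 hu with hu | hu
    · obtain ⟨r, hr, hru⟩ := hF.cover u hu
      exact ⟨r, Finset.mem_union_left _ hr, hru.mono le_sup_left⟩
    · obtain ⟨r, hr, hru⟩ := hF'.cover u hu
      exact ⟨r, Finset.mem_union_right _ hr, hru.mono le_sup_right⟩
  · intro v hv a b hva hvb
    rw [Finset.mem_union, not_or] at hv
    have hd : ∀ c c', F.Adj v c → F'.Adj v c' → False := fun c c' h h' =>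
      Finset.disjoint_left.1 hXY (hF.le h).2.1 (hF'.le h').2.1
    rcases hva with ha | ha <;> rcases hvb with hb | hb
    · exact hF.branch v hv.1 a b ha hb
    · exact (hd _ _ ha hb).elim
    · exact (hd _ _ hb ha).elim
    · exact hF'.branch v hv.2 a b ha hb
  · rw [Finset.inter_union_distrib_left, Finset.card_union_of_disjoint
      (hXY.mono Finset.inter_subset_right Finset.inter_subset_right)]
    have h1 := Finset.card_union_le R R'
    have h2 := Finset.card_union_le J J'
    push_cast
    omega

/-- The induced graph is taken as one component. Vertices of degree at least two in it are
non-leaves of `T`, and the 1 pays for the representative. -/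
lemma ConnectedOn.excessLE_one (hX : ConnectedOn T X) : ExcessLE T X 1 := by
  rcases X.eq_empty_or_nonempty with rfl | ⟨x, hx⟩
  · exact excessLE_empty.mono zero_le_one
  refine ⟨restrict T X, {x}, nonLeaves T ∩ X, ⟨le_rfl, fun u hu => ⟨x, by simp, hX x hx u hu⟩, ?_⟩,
    by simp; omega⟩
  intro v hv a b hva hvb
  have hl : IsLeaf T v := by
    by_contra hl
    exact hv (Finset.mem_inter.2 ⟨mem_nonLeaves.2 hl, hva.2.1⟩)
  exact hl.atMostOneNeighbour _ _ hva.1 hvb.1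

/-- The single component on `X` has the non-leaf `u` as an end, so `u` is omitted from `J`, and this
pays for the representative. -/
lemma ConnectedOn.excessLE_zero (hX : ConnectedOn T X) {u : V} (hu : u ∈ X) (hul : ¬ IsLeaf T u)
    (hone : ∀ a ∈ X, ∀ b ∈ X, T.Adj u a → T.Adj u b → a = b) : ExcessLE T X 0 := by
  have huI : u ∈ nonLeaves T ∩ X := Finset.mem_inter.2 ⟨mem_nonLeaves.2 hul, hu⟩
  refine ⟨restrict T X, {u}, (nonLeaves T ∩ X).erase u,
    ⟨le_rfl, fun w hw => ⟨u, by simp, hX u hu w hw⟩, ?_⟩, ?_⟩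
  · intro v hv a b hva hvb
    by_cases hvu : v = u
    · subst hvu
      exact hone a hva.2.2 b hvb.2.2 hva.1 hvb.1
    · have hl : IsLeaf T v := by
        by_contra hl
        exact hv (Finset.mem_erase.2 ⟨hvu, Finset.mem_inter.2 ⟨mem_nonLeaves.2 hl, hva.2.1⟩⟩)
      exact hl.atMostOneNeighbour _ _ hva.1 hvb.1
  · have := Finset.card_erase_add_one huI
    rw [Finset.card_singleton]
    omega

/-- By acyclicity `u` sends a single edge to `X`, so it is an end of the enlarged tree. -/
lemma ConnectedOn.excessLE_insert (hT : T.IsAcyclic) (hX : ConnectedOn T X) {u a : V} (hu : u ∉ X)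
    (ha : a ∈ X) (hua : T.Adj u a) (hul : ¬ IsLeaf T u) : ExcessLE T (insert u X) 0 := by
  refine (hX.insert_of_adj ha hua).excessLE_zero (Finset.mem_insert_self _ _) hul ?_
  intro b hb c hc hub huc
  have hb' := Finset.mem_of_mem_insert_of_ne hb hub.ne'
  have hc' := Finset.mem_of_mem_insert_of_ne hc huc.ne'
  exact ((connectedOn_singleton u).eq_and_eq_of_adj hT hX (by simpa using hu)
    (Finset.mem_singleton_self u) (Finset.mem_singleton_self u) hb' hc' hub huc).2

/-- If all components of `Z` have positive value, then the excess of `Z` is at most its value. -/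
lemma excessLE_of_pieces (ω : V → ℤ) (Z : Finset V)
    (h : ∀ C, IsPiece T Z C → 1 ≤ ∑ v ∈ C, ω v) : ExcessLE T Z (∑ v ∈ Z, ω v) := by
  induction hn : Z.card using Nat.strong_induction_on generalizing Z with
  | _ n ih =>
    subst hn
    rcases Z.eq_empty_or_nonempty with rfl | ⟨z, hz⟩
    · simpa using excessLE_empty
    obtain ⟨C, hC, hzC⟩ := exists_isPiece (T := T) hz
    have h1 := ih (Z \ C).card (Finset.card_lt_card ⟨Finset.sdiff_subset, fun hs =>
      (Finset.mem_sdiff.1 (hs hz)).2 hzC⟩) (Z \ C) (fun C' hC' => h C' (hC.of_sdiff hC')) rfl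
    have h2 := h1.union (hC.connected.excessLE_one.mono (h C hC)) Finset.sdiff_disjoint
    rwa [Finset.sdiff_union_of_subset hC.subset, Finset.sum_sdiff hC.subset] at h2

end Excess

/-! ### From loner leaves to a light forest -/

section Backward

/-- A representative vertex of a component. -/
noncomputable def representative {V : Type*} {F : SimpleGraph V} (c : F.ConnectedComponent) : V :=
  Quot.out c

lemma mk_representative {V : Type*} {F : SimpleGraph V} (c : F.ConnectedComponent) :
    F.connectedComponentMk (representative c) = c :=
  Quot.out_eq c

open Classical in
/-- The number of large components of `F`, each counted at a representative vertex, minus the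
number of leaves of `F` which are loners of `T`, as a sum of contributions of vertices. -/
noncomputable def value {V : Type*} (T F : SimpleGraph V) (v : V) : ℤ :=
  (if 3 ≤ (F.connectedComponentMk v).supp.ncard ∧ representative (F.connectedComponentMk v) = v
    then 1 else 0) - (if IsLoner T v ∧ IsLeaf F v then 1 else 0)

lemma neg_one_le_value {V : Type*} {F T : SimpleGraph V} (v : V) : -1 ≤ value T F v := by
  unfold value
  split_ifs <;> simp

variable {V : Type*} [Fintype V] [DecidableEq V] {F T : SimpleGraph V}

/-- The set `A` is a union of components of `F`. -/
def IsSaturated (F : SimpleGraph V) (A : Finset V) : Prop :=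
  ∀ x ∈ A, ∀ y, F.Adj x y → y ∈ A

open Classical in
/-- The vertex set of the component of `F` containing `x`. -/
noncomputable def componentFinset (F : SimpleGraph V) (x : V) : Finset V :=
  Finset.univ.filter fun y => F.Reachable x y

lemma mem_componentFinset {x y : V} : y ∈ componentFinset F x ↔ F.Reachable x y := by
  simp [componentFinset]

lemma self_mem_componentFinset (x : V) : x ∈ componentFinset F x :=
  mem_componentFinset.2 (Reachable.refl x)

lemma isSaturated_componentFinset (x : V) : IsSaturated F (componentFinset F x) := by
  intro y hy z hyz
  exact mem_componentFinset.2 ((mem_componentFinset.1 hy).trans hyz.reachable)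

lemma IsSaturated.componentFinset_subset {A : Finset V} (hA : IsSaturated F A) {x : V}
    (hx : x ∈ A) : componentFinset F x ⊆ A := fun _ hy =>
  mem_of_reachable_of_closed (X := (A : Set V)) hA hx (mem_componentFinset.1 hy)

lemma connectedOn_componentFinset (h : F ≤ T) (x : V) : ConnectedOn T (componentFinset F x) := by
  refine ConnectedOn.of_forall_reachable (x := x) fun a ha => ?_
  exact ((reachable_restrict_of_closed (isSaturated_componentFinset x)
    (self_mem_componentFinset x) (mem_componentFinset.1 ha)).mono
    (restrict_mono h subset_rfl)).symm

lemma sum_value_univ {V : Type*} [Fintype V] {F T : SimpleGraph V} : ∑ v, value T F v =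
    ({c : F.ConnectedComponent | 3 ≤ c.supp.ncard}.ncard : ℤ) -
      {v : V | IsLoner T v ∧ IsLeaf F v}.ncard := by
  classical
  simp only [value, Finset.sum_sub_distrib]
  congr 1
  · rw [← Finset.sum_filter, Finset.sum_const, nsmul_eq_mul, mul_one, Nat.cast_inj,
      ← Set.ncard_coe_finset]
    symm
    refine Set.ncard_congr (fun c _ => representative c) ?_ ?_ ?_
    · intro c hc
      simpa [mk_representative] using hc
    · intro c c' _ _ h
      rw [← mk_representative c, ← mk_representative c', h]
    · intro v hv
      have hv' := (Finset.mem_filter.1 (Finset.mem_coe.1 hv)).2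
      exact ⟨_, hv'.1, hv'.2⟩
  · rw [← Finset.sum_filter, Finset.sum_const, nsmul_eq_mul, mul_one, Nat.cast_inj,
      ← Set.ncard_coe_finset]
    congr 1
    ext v
    simp

lemma coe_componentFinset (x : V) :
    (componentFinset F x : Set V) = (F.connectedComponentMk x).supp := by
  ext y
  rw [Finset.mem_coe, mem_componentFinset]
  exact ⟨fun h => ConnectedComponent.sound h.symm, fun h => (ConnectedComponent.exact h).symm⟩

open Classical in
lemma sum_value_componentFinset (x : V) : ∑ v ∈ componentFinset F x, value T F v =
    (if 3 ≤ (componentFinset F x).card then 1 else 0) -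
      (((componentFinset F x).filter fun v => IsLoner T v ∧ IsLeaf F v).card : ℤ) := by
  simp only [value, Finset.sum_sub_distrib]
  congr 1
  · have hmk : ∀ v ∈ componentFinset F x, F.connectedComponentMk v = F.connectedComponentMk x :=
      fun v hv => ConnectedComponent.sound (mem_componentFinset.1 hv).symm
    have hout := mk_representative (F.connectedComponentMk x)
    rw [Finset.sum_eq_single (representative (F.connectedComponentMk x)), hout, ← coe_componentFinset,
      Set.ncard_coe_finset]
    · simp
    · intro v hv hne
      rw [hmk v hv, if_neg]
      exact fun h => hne h.2.symm
    · intro h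
      exact absurd (mem_componentFinset.2 (ConnectedComponent.exact hout).symm) h
  · rw [← Finset.sum_filter, Finset.sum_const, nsmul_eq_mul, mul_one]

/-- The excess of a component of `F` is at most its value, except for a pair of loners. -/
lemma excessLE_componentFinset (hT : T.Connected) (hV : 3 ≤ Nat.card V) (hle : F ≤ T)
    (hF : ∀ v, ∃ a, F.Adj v a) (x : V) :
    ExcessLE T (componentFinset F x) (∑ v ∈ componentFinset F x, value T F v) ∨
      ∃ u v, T.Adj u v ∧ componentFinset F x = {u, v} ∧ IsLoner T u ∧ IsLoner T v := by
  classical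
  rw [sum_value_componentFinset]
  set P := componentFinset F x with hP
  have hPsat : IsSaturated F P := isSaturated_componentFinset x
  set J := P.filter fun v => ¬ AtMostOneNeighbour F v with hJ
  set L := P.filter fun v => IsLoner T v ∧ IsLeaf F v with hL
  have hJL : Disjoint J L := by
    rw [Finset.disjoint_left]
    intro v hvJ hvL
    exact (Finset.mem_filter.1 hvJ).2 (Finset.mem_filter.1 hvL).2.2.atMostOneNeighbour
  have hJI : J ⊆ nonLeaves T ∩ P := fun v hv => by
    obtain ⟨hvP, hv⟩ := Finset.mem_filter.1 hv
    refine Finset.mem_inter.2 ⟨mem_nonLeaves.2 fun hl => hv ?_, hvP⟩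
    exact fun a b ha hb => hl.atMostOneNeighbour a b (hle ha) (hle hb)
  have hLI : L ⊆ nonLeaves T ∩ P := fun v hv => by
    obtain ⟨hvP, hv⟩ := Finset.mem_filter.1 hv
    exact Finset.mem_inter.2 ⟨mem_nonLeaves.2 hv.1.1, hvP⟩
  have hforest : ForestBound (restrict T P) P (restrict F P) {x} J := by
    refine ⟨restrict_mono hle subset_rfl, fun y hy => ⟨x, by simp, ?_⟩, ?_⟩
    · exact reachable_restrict_of_closed hPsat (self_mem_componentFinset x)
        (mem_componentFinset.1 hy)
    · intro v hv a b hva hvb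
      by_contra hab
      exact hv (Finset.mem_filter.2 ⟨hva.2.1, fun h => hab (h a b hva.1 hvb.1)⟩)
  by_cases h3 : 3 ≤ P.card
  · left
    refine ⟨_, _, _, hforest, ?_⟩
    -- Inner vertices and loner leaves of the component are disjoint sets of non-leaves of `T`.
    have := Finset.card_le_card (Finset.union_subset hJI hLI)
    rw [Finset.card_union_of_disjoint hJL] at this
    rw [if_pos h3, Finset.card_singleton]
    push_cast
    omega
  · obtain ⟨y, hxy⟩ := hF x
    have hyP : y ∈ P := hPsat x (self_mem_componentFinset x) y hxy
    have hPe : P = {x, y} := by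
      symm
      refine Finset.eq_of_subset_of_card_le ?_ ?_
      · intro z hz
        rcases Finset.mem_insert.1 hz with rfl | hz
        · exact self_mem_componentFinset z
        · rw [Finset.mem_singleton.1 hz]
          exact hyP
      · rw [Finset.card_pair hxy.ne]
        omega
    by_cases hlon : IsLoner T x ∧ IsLoner T y
    · exact Or.inr ⟨x, y, hle hxy, hPe, hlon.1, hlon.2⟩
    left
    -- A non-leaf of the pair that is not a loner pays for the representative: a non-loner end that
    -- is a leaf of `T` makes the other end such a vertex.
    obtain ⟨w, hw, hwl⟩ : ∃ w ∈ nonLeaves T ∩ P, ¬ IsLoner T w := by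
      have key : ∀ a ∈ P, ∀ b ∈ P, T.Adj a b → ¬ IsLoner T a →
          ∃ w ∈ nonLeaves T ∩ P, ¬ IsLoner T w := by
        intro a ha b hb hab hal
        by_cases haL : IsLeaf T a
        · refine ⟨b, Finset.mem_inter.2 ⟨mem_nonLeaves.2
            (not_isLeaf_of_adj_isLeaf hT hV hab haL), hb⟩, fun hbl => ?_⟩
          exact hbl.2 a hab.symm haL
        · exact ⟨a, Finset.mem_inter.2 ⟨mem_nonLeaves.2 haL, ha⟩, hal⟩
      by_cases hxl : IsLoner T x
      · exact key y hyP x (self_mem_componentFinset x) (hle hxy).symm fun h => hlon ⟨hxl, h⟩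
      · exact key x (self_mem_componentFinset x) y hyP (hle hxy) hxl
    have hJ0 : J = ∅ := by
      refine Finset.filter_eq_empty_iff.2 fun v hv => not_not.2 ?_
      intro a b ha hb
      have hmem := fun c (hc : F.Adj v c) => hPsat v hv c hc
      have h1 := hmem a ha
      have h2 := hmem b hb
      have h3 := ha.ne
      have h4 := hb.ne
      rw [hPe, Finset.mem_insert, Finset.mem_singleton] at hv h1 h2
      grind
    refine ⟨_, _, _, hforest, ?_⟩
    have hsub : L ⊆ (nonLeaves T ∩ P).erase w := fun v hv => Finset.mem_erase.2
      ⟨fun h => hwl (h ▸ (Finset.mem_filter.1 hv).2.1), hLI hv⟩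
    have h1 := Finset.card_le_card hsub
    have h2 := Finset.card_erase_add_one hw
    rw [if_neg h3, Finset.card_singleton, hJ0, Finset.card_empty]
    push_cast
    omega

/-- A connected set with a component of `F` around which all pieces have positive value. -/
lemma excessLE_zero_of_center (hT : T.IsTree) (hV : 3 ≤ Nat.card V) (hle : F ≤ T)
    (hF : ∀ v, ∃ a, F.Adj v a) {A : Finset V} (hA : ConnectedOn T A) (hAF : IsSaturated F A)
    (hval : ∑ v ∈ A, value T F v ≤ 0) {x : V} (hx : x ∈ A)
    (hpos : ∀ C, IsPiece T (A \ componentFinset F x) C → 1 ≤ ∑ v ∈ C, value T F v) :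
    ExcessLE T A 0 := by
  have hPA := hAF.componentFinset_subset hx
  have hPconn := connectedOn_componentFinset hle x
  have hsumP := Finset.sum_sdiff (f := value T F) hPA
  rcases excessLE_componentFinset hT.connected hV hle hF x with h | ⟨u, v, huv, hP, hu, hv⟩
  · have := (excessLE_of_pieces _ _ hpos).union h Finset.sdiff_disjoint
    rw [Finset.sdiff_union_of_subset hPA, hsumP] at this
    exact this.mono hval
  -- The center is a pair of loners. If one end has no further neighbour in `A`, then `A` as a
  -- single tree has that non-leaf of `T` as an end. Otherwise the pair is cut apart.
  rw [hP] at hPA hsumP hpos hPconn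
  have huA : u ∈ A := hPA (by simp)
  have hvA : v ∈ A := hPA (by simp)
  by_cases hua : ∃ a ∈ A, T.Adj u a ∧ a ≠ v
  swap
  · push Not at hua
    exact hA.excessLE_zero huA hu.1 fun a ha b hb h1 h2 => (hua a ha h1).trans (hua b hb h2).symm
  by_cases hvb : ∃ b ∈ A, T.Adj v b ∧ b ≠ u
  swap
  · push Not at hvb
    exact hA.excessLE_zero hvA hv.1 fun a ha b hb h1 h2 => (hvb a ha h1).trans (hvb b hb h2).symm
  obtain ⟨a, haA, hua, hav⟩ := hua
  obtain ⟨b, hbA, hvb, hbu⟩ := hvb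
  have haZ : a ∈ A \ {u, v} := by simp [haA, hav, hua.ne']
  have hbZ : b ∈ A \ {u, v} := by simp [hbA, hbu, hvb.ne']
  obtain ⟨C, hC, haC⟩ := exists_isPiece (T := T) haZ
  have hCP : Disjoint {u, v} C := by
    rw [Finset.disjoint_left]
    intro y hy hyC
    exact (Finset.mem_sdiff.1 (hC.subset hyC)).2 hy
  have hbC : b ∉ C := fun hbC => huv.ne
    (hPconn.eq_and_eq_of_adj hT.isAcyclic hC.connected hCP (by simp) (by simp) haC hbC hua hvb).1
  obtain ⟨C', hC', hbC'⟩ := exists_isPiece (T := T) (Finset.mem_sdiff.2 ⟨hbZ, hbC⟩)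
  have hC'' := hC.of_sdiff hC'
  have hrest := excessLE_of_pieces (value T F) (((A \ {u, v}) \ C) \ C')
    (fun D hD => hpos D (hC.of_sdiff (hC'.of_sdiff hD)))
  have hnotC : ∀ y ∈ C, y ∈ A ∧ y ≠ u ∧ y ≠ v := fun y hy => by
    have := hC.subset hy
    simpa using this
  have hnotC' : ∀ y ∈ C', y ∈ A ∧ (y ≠ u ∧ y ≠ v) ∧ y ∉ C := fun y hy => by
    have := hC'.subset hy
    simpa [and_assoc] using this
  -- Each end joins a piece on its own side with excess 0. The two pieces have value at least 1
  -- each, offsetting the value -2 of the pair, so the remaining pieces have total value at most 0.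
  have e1 := hC.connected.excessLE_insert hT.isAcyclic (fun h => (hnotC u h).2.1 rfl) haC hua hu.1
  have e2 := hC''.connected.excessLE_insert hT.isAcyclic (fun h => (hnotC' v h).2.1.2 rfl) hbC'
    hvb hv.1
  have h12 := e1.union e2 (by
    rw [Finset.disjoint_left]
    intro y hy hy'
    have := huv.ne
    rcases Finset.mem_insert.1 hy with rfl | hy <;> rcases Finset.mem_insert.1 hy' with rfl | hy'
    · exact this rfl
    · exact (hnotC' y hy').2.1.1 rfl
    · exact (hnotC y hy).2.2 rfl
    · exact (hnotC' y hy').2.2 hy)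
  have h123 := h12.union hrest (by
    rw [Finset.disjoint_left]
    intro y hy hy'
    simp only [Finset.mem_union, Finset.mem_insert, Finset.mem_sdiff, Finset.mem_singleton]
      at hy hy'
    tauto)
  have hunion : insert u C ∪ insert v C' ∪ (((A \ {u, v}) \ C) \ C') = A := by
    ext y
    have h1 := hnotC y
    have h2 := hnotC' y
    simp only [Finset.mem_union, Finset.mem_insert, Finset.mem_sdiff, Finset.mem_singleton]
    grind
  rw [hunion] at h123
  refine h123.mono ?_
  have s1 := Finset.sum_sdiff (f := value T F) hC.subset
  have s2 := Finset.sum_sdiff (f := value T F) hC'.subset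
  have s3 := hpos C hC
  have s4 := hpos C' hC''
  have s5 : -2 ≤ ∑ y ∈ {u, v}, value T F y := by
    rw [Finset.sum_pair huv.ne]
    have := neg_one_le_value (T := T) (F := F) u
    have := neg_one_le_value (T := T) (F := F) v
    omega
  omega

/-- A connected union of components of `F` of nonpositive value has nonpositive excess. -/
theorem excessLE_zero (hT : T.IsTree) (hV : 3 ≤ Nat.card V) (hle : F ≤ T)
    (hF : ∀ v, ∃ a, F.Adj v a) (A : Finset V) (hA : ConnectedOn T A) (hAF : IsSaturated F A)
    (hval : ∑ v ∈ A, value T F v ≤ 0) : ExcessLE T A 0 := by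
  classical
  induction hn : A.card using Nat.strong_induction_on generalizing A with
  | _ n ih =>
  subst hn
  rcases A.eq_empty_or_nonempty with rfl | hne
  · exact excessLE_empty
  -- `X` is a smallest part of nonpositive value that can be split off with both sides connected;
  -- `A` itself is admitted.
  obtain ⟨X, hXmem, hXmin⟩ := (A.powerset.filter fun X => X.Nonempty ∧ IsSaturated F X ∧
      ConnectedOn T X ∧ ConnectedOn T (A \ X) ∧ ∑ v ∈ X, value T F v ≤ 0).exists_min_image
    Finset.card ⟨A, by
      simp only [Finset.mem_filter, Finset.mem_powerset, subset_rfl, true_and]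
      refine ⟨hne, hAF, hA, ?_, hval⟩
      rw [Finset.sdiff_self]
      exact fun a ha => absurd ha (Finset.notMem_empty a)⟩
  simp only [Finset.mem_filter, Finset.mem_powerset] at hXmem hXmin
  obtain ⟨hXA, hXne, hXF, hX, hY, hXval⟩ := hXmem
  have hsmall : ∀ x ∈ A, ∀ C, IsPiece T (A \ componentFinset F x) C → C ⊂ X →
      1 ≤ ∑ v ∈ C, value T F v := by
    intro x hx C hC hCX
    by_contra hcon
    have hPA := hAF.componentFinset_subset hx
    refine absurd (hXmin C ⟨hC.subset.trans Finset.sdiff_subset, hC.nonempty, ?_, hC.connected,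
      hA.sdiff_isPiece (connectedOn_componentFinset hle x) hPA ⟨x, self_mem_componentFinset x⟩ hC,
      by omega⟩) (not_le.2 (Finset.card_lt_card hCX))
    intro y hy z hyz
    obtain ⟨hyA, hyP⟩ := Finset.mem_sdiff.1 (hC.subset hy)
    refine hC.closed y hy z (Finset.mem_sdiff.2 ⟨hAF y hyA z hyz, fun hzP => hyP ?_⟩) (hle hyz)
    exact isSaturated_componentFinset x z hzP y hyz.symm
  by_cases hXA' : A ⊆ X
  · obtain ⟨x, hx⟩ := hne
    refine excessLE_zero_of_center hT hV hle hF hA hAF hval hx fun C hC =>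
      hsmall x hx C hC ⟨hC.subset.trans (Finset.sdiff_subset.trans hXA'), fun hs => ?_⟩
    exact (Finset.mem_sdiff.1 (hC.subset (hs (hXA' hx)))).2 (self_mem_componentFinset x)
  obtain ⟨w, hwA, hwX⟩ := Finset.not_subset.1 hXA'
  obtain ⟨x₀, hx₀⟩ := hXne
  have hYF : IsSaturated F (A \ X) := by
    intro y hy z hyz
    obtain ⟨hyA, hyX⟩ := Finset.mem_sdiff.1 hy
    exact Finset.mem_sdiff.2 ⟨hAF y hyA z hyz, fun hz => hyX (hXF z hz y hyz.symm)⟩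
  by_cases hYval : ∑ v ∈ A \ X, value T F v ≤ 0
  · have h1 := ih X.card (Finset.card_lt_card ⟨hXA, hXA'⟩) X hX hXF hXval rfl
    have h2 := ih (A \ X).card (Finset.card_lt_card ⟨Finset.sdiff_subset, fun hs =>
      (Finset.mem_sdiff.1 (hs (hXA hx₀))).2 hx₀⟩) (A \ X) hY hYF hYval rfl
    have := h1.union h2 Finset.disjoint_sdiff
    rwa [Finset.union_sdiff_of_subset hXA, add_zero] at this
  -- The center is the component at the end in `X` of the unique edge leaving `X`. The pieces around
  -- it are `A \ X`, of positive value here, and proper subsets of `X`, of positive value by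
  -- minimality.
  obtain ⟨x, hx, y, hyX, hxy, -, hyA⟩ := exists_adj_of_reachable (X := (X : Set V))
    (hA x₀ (hXA hx₀) w hwA) hx₀ hwX
  have hyY : y ∈ A \ X := Finset.mem_sdiff.2 ⟨hyA, hyX⟩
  have hPX := hXF.componentFinset_subset hx
  have hYZ : A \ X ⊆ A \ componentFinset F x := Finset.sdiff_subset_sdiff subset_rfl hPX
  refine excessLE_zero_of_center hT hV hle hF hA hAF hval (hXA hx) fun C hC => ?_
  have hxC : x ∉ C := fun h => (Finset.mem_sdiff.1 (hC.subset h)).2 (self_mem_componentFinset x)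
  have hCA : C ⊆ A := hC.subset.trans Finset.sdiff_subset
  by_cases hCY : ∃ y' ∈ C, y' ∉ X
  · obtain ⟨y', hy'C, hy'X⟩ := hCY
    have hsub := hC.subset_of_mem hY hYZ (Finset.mem_sdiff.2 ⟨hCA hy'C, hy'X⟩) hy'C
    have hCeq : C = A \ X := by
      refine Finset.Subset.antisymm (fun c hc => Finset.mem_sdiff.2 ⟨hCA hc, fun hcX => ?_⟩) hsub
      obtain ⟨a, haX, b, hbX, hab, haC, hbC⟩ := exists_adj_of_reachable (X := (X : Set V))
        (hC.connected c hc y' hy'C) hcX hy'X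
      have := (hX.eq_and_eq_of_adj hT.isAcyclic hY Finset.disjoint_sdiff hx haX hyY
        (Finset.mem_sdiff.2 ⟨hCA hbC, hbX⟩) hxy hab).1
      exact hxC (this ▸ haC)
    rw [hCeq]
    omega
  · push Not at hCY
    exact hsmall x (hXA hx) C hC ⟨hCY, fun hs => hxC (hs hx)⟩

end Backward

/-! ### The equivalence -/

lemma atMostOneNeighbour_of_card_le_two {V : Type*} [Finite V] (hV : Nat.card V ≤ 2)
    (T : SimpleGraph V) (v : V) : AtMostOneNeighbour T v := by
  classical
  have := Fintype.ofFinite V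
  intro a b ha hb
  by_contra hab
  have h3 : ({v, a, b} : Finset V).card = 3 := Finset.card_eq_three.2
    ⟨v, a, b, ha.ne, hb.ne, hab, rfl⟩
  have := Finset.card_le_univ ({v, a, b} : Finset V)
  rw [← Nat.card_eq_fintype_card] at this
  omega

lemma ForestBound.mEternalDominationNumber_le {V : Type*} [Fintype V] {T F : SimpleGraph V}
    {R J : Finset V} (h : ForestBound T Finset.univ F R J) (hT : T.IsAcyclic) :
    mEternalDominationNumber T ≤ R.card + J.card := by
  obtain ⟨D, hD, hc⟩ := h.exists_isMEternalDominating hT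
  have hmem : D.card ∈ {k | ∃ D : Finset V, IsMEternalDominating T D ∧ D.card = k} := ⟨D, hD, rfl⟩
  exact (Nat.sInf_le hmem).trans hc

end EternalDomination

open EternalDomination in
theorem proposition3p1 {V : Type*} [Finite V] (hV : 2 ≤ Nat.card V)
    (T : SimpleGraph V) (hT : T.IsTree) :
    mEternalDominationNumber T < 1 + connectedDominationNumber T ↔
      ∃ (r k : ℕ) (F : SimpleGraph V), IsSpanningForestOfType T F r k ∧
        k ≤ {v : V | IsLoner T v ∧ IsLeaf F v}.ncard := by
  classical
  have := Fintype.ofFinite V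
  have hadj := exists_adj_of_connected hT.connected hV
  rcases hV.lt_or_eq with hV3 | hV2
  · constructor
    · intro hlt
      obtain ⟨D, hD, hDcard⟩ := exists_isMEternalDominating_card_eq T
      obtain ⟨F, R, J, hF, hcard⟩ := hD.exists_forestBound hT.isAcyclic
      have hγ := connectedDominationNumber_le_card_nonLeaves hT hV3
      obtain ⟨F, R, J, hF, hcard, hiso⟩ := (hF Finset.univ).exists_no_isolated
        (m := (nonLeaves T).card) (by omega) hadj
      exact ⟨_, _, F, isSpanningForestOfType hF.le hT.isAcyclic hiso, hF.card_large_le hiso hcard⟩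
    · rintro ⟨r, k, F, hF, hk⟩
      have hiso : ∀ v, ∃ a, F.Adj v a := by
        intro v
        by_contra hv
        push Not at hv
        have : (F.connectedComponentMk v).supp = {v} := by
          ext y
          constructor
          · exact fun hy => eq_of_reachable_of_isolated hv (SimpleGraph.ConnectedComponent.exact hy).symm
          · rintro rfl
            rfl
        have h := hF.components (F.connectedComponentMk v)
        rw [this, Set.ncard_singleton] at h
        omega
      have hval : ∑ v, value T F v ≤ 0 := by
        rw [sum_value_univ, hF.card_large]
        omega
      have huniv : restrict T Finset.univ = T := by
        ext a b
        simp [restrict]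
      obtain ⟨F', R, J, hF', hcard⟩ := excessLE_zero hT hV3 hF.le hiso Finset.univ
        (fun a _ b _ => by rw [huniv]; exact hT.connected.preconnected a b)
        (fun _ _ y _ => Finset.mem_univ y) hval
      rw [huniv] at hF'
      rw [Finset.inter_univ] at hcard
      have h1 := hF'.mEternalDominationNumber_le hT.isAcyclic
      have h2 := card_nonLeaves_le_connectedDominationNumber hT hV
      omega
  -- For K₂ both sides hold: the tree itself has weight 1 and no large component.
  · have hsupp : ∀ c : T.ConnectedComponent, c.supp.ncard ≤ 2 := fun c => by
      rw [hV2, ← Set.ncard_univ]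
      exact Set.ncard_le_ncard (Set.subset_univ _) (Set.toFinite _)
    refine iff_of_true ?_ ⟨_, _, T, isSpanningForestOfType le_rfl hT.isAcyclic hadj, ?_⟩
    · obtain ⟨v⟩ := hT.connected.nonempty
      have hB : ForestBound T Finset.univ T {v} ∅ :=
        ⟨le_rfl, fun u _ => ⟨v, by simp, hT.connected.preconnected v u⟩,
          fun w _ => atMostOneNeighbour_of_card_le_two hV2.ge T w⟩
      have h1 := hB.mEternalDominationNumber_le hT.isAcyclic
      have h2 := connectedDominationNumber_pos hT
      rw [Finset.card_singleton, Finset.card_empty] at h1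
      omega
    · have : {c : T.ConnectedComponent | 3 ≤ c.supp.ncard} = ∅ := by
        ext c
        have := hsupp c
        simp only [Set.mem_ofPred_eq, Set.mem_empty_iff_false, iff_false]
        omega
      rw [this, Set.ncard_empty]
      exact Nat.zero_le _
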